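/- **Setting.** Polynomial time means polynomial-size families $(C_n)_n$ of probabilistic Boolean circuits with oracle gates, one circuit for each word size $n$. A function of $n$ is negligible if it tends to $0$ faster than every inverse polynomial. *Encryption.* Fix $w$. For each $n$ let $\mathcal E$ be a (randomized) correct secret-key encryption, with ciphertexts of length polynomial in $n$, of plaintexts consisting of $w$ bits of hidden padding and an $n$-bit word. *Platform.* The processor has a set of primitive binary operations $\theta$ and binary tests $R$ on $n$-bit words, each computed by circuits of size polynomial in $n$. Its instructions are $r_0\leftarrow (r_1-k_1)\,\theta\,(r_2-k_2)+k_0$, copy $r_0\leftarrow r_1$, jump, and "branch if $(r_1-k_1)\,R\,(r_2-k_2)$", with arithmetic mod $2^n$. Locations (registers and memory) hold encrypted words and the constants $k_i$ are embedded encrypted; the processor takes encrypted inputs to freshly encrypted outputs. The padding distinguishes runtime data from constants, and constants of different opcodes or positions; an instruction given a word of the wrong kind yields random nonsense (a uniformly random word or bit). *Chaotic compilation.* A nominal program has finitely many locations and instructions $r_0\leftarrow (r_1\,\theta\,r_2)+v$, copy, jump, and "branch if $r_1\,R\,r_2$". An obfuscation scheme $D$ assigns an $n$-bit offset to each location at each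 program point, such that along each control-flow edge the offset of every location that is not written is unchanged and a copy preserves the data exactly (so offsets agree where control paths join). The compiler picks $D$ uniformly at random among all these schemes and sets the constants and the input data so that every content is offset from its nominal value as $D$ says: $k_1,k_2$ are the offsets of $r_1,r_2$ before the instruction, and $k_0$ is $v$ plus the offset of $r_0$ after it. *Game.* For each $n$ the operator selects a nominal program $P_n$ (of any length; for example one program unrolled, with its branches bundled, to any super-polynomial length) and input data $d_n$. The user compiles them chaotically and encrypts the compiled code's constants and the data. The operator knows $P_n$ and $d_n$ but neither the key nor $D$. It sees the encrypted content of polynomially many initial locations and code addresses of its choice and may have the platform execute any instruction with any opcode on encrypted constants and operands that it supplies, seeing the encrypted result or the branch decision, as often as polynomial time allows. It is *restricted* if words other than ciphertexts that it has been shown are always treated as being of the wrong kind, and *unrestricted* if it may supply arbitrary words, which the platform decrypts. **Claim.** If $\mathcal E$ is IND-CPA secure (left-or-right) against polynomial time, then for every restricted polynomial-time operator: 1. for every location $r_n$ and time $t_n$ in the run of the compiled $P_n$ on the compiled $d_n$, and every attribute $\varphi_n$ of $n$-bit words (for example the whole word), the probability that the operator's output is $\varphi_n(x)$, where $x$ is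 the plaintext beneath the encryption in $r_n$ after $t_n$ steps, exceeds chance $\max_y |\{x:\varphi_n(x)=\varphi_n(y)\}|/2^n$ by at most a negligible amount; 2. the probability that the operator outputs an encrypted data word (in the restricted case, one that it has been shown) together with the plaintext beneath it exceeds $2^{-n}$ by at most a negligible amount. If moreover $\mathcal E$ has ciphertext integrity (INT-CTXT: no polynomial-time forger with an encryption oracle produces, with non-negligible probability, a valid ciphertext that it was not issued), then 1 and 2 hold for every unrestricted polynomial-time operator. -/

import Mathlib

/-- A natural-number valued quantity is polynomially bounded in the word size `n`. -/
def PolyBounded (f : ℕ → ℕ) : Prop :=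
  ∃ p : Polynomial ℕ, ∀ n, f n ≤ p.eval n

/-- `ε` tends to zero faster than the inverse of every polynomial. -/
def Negligible (ε : ℕ → ℝ) : Prop :=
  Asymptotics.SuperpolynomialDecay Filter.atTop (fun n : ℕ => (n : ℝ)) ε

/-- The probability of the event `S` under `p`, as a real number. -/
noncomputable def prob {α : Type} (p : PMF α) (S : Set α) : ℝ :=
  (p.toOuterMeasure S).toReal

/-! ### Bit strings -/

/-- The bits of a word, least significant first. -/
def wordBits {n : ℕ} (x : BitVec n) : List Bool :=
  List.ofFn fun i : Fin n => x.getLsb i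

/-- The `n`-bit word that starts at position `off` of a bit string (missing bits are `false`). -/
def readWord (n off : ℕ) (s : List Bool) : BitVec n :=
  BitVec.ofFnLE fun i : Fin n => s.getD (off + i) false

/-! ### Circuits

Polynomial time is measured by polynomial-size families of circuits, one circuit for each word
size.  A circuit is a list of gates; each gate appends its output bits to the list of wires, and
a wire that is not there carries `false`. -/

/-- The value of wire `i`. -/
def wire (ws : List Bool) (i : ℕ) : Bool := ws.getD i false

/-- A circuit of NAND gates, used for the arithmetic units of the processor.  Gate `(i, j)` appends
the NAND of wires `i` and `j`; `out` lists the output wires. -/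
structure LogicCircuit where
  gates : List (ℕ × ℕ)
  out : List ℕ

/-- Number of gates and of output pins. -/
def LogicCircuit.size (C : LogicCircuit) : ℕ := C.gates.length + C.out.length

/-- The output bits of a logic circuit on given input bits. -/
def LogicCircuit.eval (C : LogicCircuit) (input : List Bool) : List Bool :=
  C.out.map (wire (C.gates.foldl (fun ws g => ws ++ [!(wire ws g.1 && wire ws g.2)]) input))

/-- A family of two-operand functions on `n`-bit words is computed by polynomial-size circuits. -/
def PolySizeComputable (f : ∀ n : ℕ, BitVec n → BitVec n → List Bool) : Prop :=
  ∃ C : ℕ → LogicCircuit, PolyBounded (fun n => (C n).size) ∧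
    ∀ n (x y : BitVec n), (C n).eval (wordBits x ++ wordBits y) = f n x y

/-- The gates of a probabilistic circuit with access to oracles indexed by `κ`. -/
inductive Gate (κ : Type) : Type
  | nand (i j : ℕ)
  | coin
  | ask (k : κ) (query : List ℕ)

/-- The cost of a gate: one step, plus one for each wire sent to an oracle. -/
def Gate.cost {κ : Type} : Gate κ → ℕ
  | .nand _ _ => 1
  | .coin => 1
  | .ask _ q => 1 + q.length

/-- A probabilistic oracle circuit with its list of output wires. -/
structure OracleCircuit (κ : Type) where
  gates : List (Gate κ)
  out : List ℕ

/-- The size of an oracle circuit: the total cost of its gates plus the number of output wires. -/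
def OracleCircuit.size {κ : Type} (C : OracleCircuit κ) : ℕ :=
  (C.gates.map Gate.cost).sum + C.out.length

/-- Runs the gates one after the other.  `O k q s` is the distribution of the reply of oracle `k`
to the query `q` in state `s`, together with its next state. -/
noncomputable def runGates {κ σ : Type} (O : κ → List Bool → σ → PMF (List Bool × σ)) :
    List (Gate κ) → List Bool → σ → PMF (List Bool × σ)
  | [], ws, s => PMF.pure (ws, s)
  | .nand i j :: gs, ws, s => runGates O gs (ws ++ [!(wire ws i && wire ws j)]) s
  | .coin :: gs, ws, s =>
      (PMF.uniformOfFintype Bool).bind fun b => runGates O gs (ws ++ [b]) s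
  | .ask k q :: gs, ws, s =>
      (O k (q.map (wire ws)) s).bind fun r => runGates O gs (ws ++ r.1) r.2

/-- The output bits and the final oracle state of an oracle circuit on given input bits. -/
noncomputable def OracleCircuit.run {κ σ : Type} (C : OracleCircuit κ)
    (O : κ → List Bool → σ → PMF (List Bool × σ)) (input : List Bool) (s : σ) :
    PMF (List Bool × σ) :=
  (runGates O C.gates input s).map fun r => (C.out.map (wire r.1), r.2)

/-! ### Encryption -/

/-- A secret-key encryption, for every `n`, of an `n`-bit word together with `w` bits of hidden
padding.  A plaintext is a pair (padding, word); `enc` may be randomized, so that a plaintext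
has many aliases; `dec` rejects by returning `none`. -/
structure Encryption (w : ℕ) where
  Key : ℕ → Type
  ctLen : ℕ → ℕ
  gen : ∀ n, PMF (Key n)
  enc : ∀ n, Key n → BitVec w × BitVec n → PMF (BitVec (ctLen n))
  dec : ∀ n, Key n → BitVec (ctLen n) → Option (BitVec w × BitVec n)
  correct : ∀ n k m c, k ∈ (gen n).support → c ∈ (enc n k m).support → dec n k c = some m
  ctLen_poly : PolyBounded ctLen

namespace Encryption

variable {w : ℕ} (E : Encryption w)

/-- The plaintext (padding, word) that starts at position `off` of a bit string. -/
def readPlain (w n off : ℕ) (s : List Bool) : BitVec w × BitVec n :=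
  (readWord w off s, readWord n (off + w) s)

/-- The left-or-right oracle: of the two plaintexts in the query, it encrypts the first if
`b` is `false` and the second if `b` is `true`. -/
noncomputable def leftRight (n : ℕ) (k : E.Key n) (b : Bool) :
    Unit → List Bool → Unit → PMF (List Bool × Unit) := fun _ q _ =>
  (E.enc n k (if b then readPlain w n (w + n) q else readPlain w n 0 q)).map fun c =>
    (wordBits c, ())

/-- The probability that a distinguisher answers `1` when facing the left-or-right oracle. -/
noncomputable def acceptProb (n : ℕ) (C : OracleCircuit Unit) (b : Bool) : ℝ :=
  prob ((E.gen n).bind fun k => C.run (E.leftRight n k b) [] ()) {r | r.1 = [true]}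

/-- Ciphertext indistinguishability under chosen-plaintext attack (IND-CPA) against
polynomial-size circuits. -/
def INDCPA : Prop :=
  ∀ C : ℕ → OracleCircuit Unit, PolyBounded (fun n => (C n).size) →
    Negligible fun n => |E.acceptProb n (C n) true - E.acceptProb n (C n) false|

/-- The encryption oracle, which records the ciphertexts it has issued. -/
noncomputable def encOracle (n : ℕ) (k : E.Key n) :
    Unit → List Bool → List (BitVec (E.ctLen n)) →
      PMF (List Bool × List (BitVec (E.ctLen n))) := fun _ q issued =>
  (E.enc n k (readPlain w n 0 q)).map fun c => (wordBits c, c :: issued)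

/-- The probability that, under chosen-plaintext attack, a forger outputs a valid ciphertext that
was not issued to it. -/
noncomputable def forgeProb (n : ℕ) (C : OracleCircuit Unit) : ℝ :=
  prob ((E.gen n).bind fun k =>
      (C.run (E.encOracle n k) [] []).map fun r => (k, readWord (E.ctLen n) 0 r.1, r.2))
    {r | r.2.1 ∉ r.2.2 ∧ (E.dec n r.1 r.2.1).isSome}

/-- Integrity of ciphertexts (INT-CTXT) against polynomial-size circuits. -/
def INTCTXT : Prop :=
  ∀ C : ℕ → OracleCircuit Unit, PolyBounded (fun n => (C n).size) →
    Negligible fun n => E.forgeProb n (C n)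

end Encryption

/-! ### The instruction set -/

/-- What an encrypted word is meant to be: runtime data, or the embedded constant in a given
position of an instruction with a given opcode. -/
inductive WordKind (Op Rel : Type) : Type
  | data
  | opConst (θ : Op) (j : Fin 3)
  | relConst (R : Rel) (j : Fin 2)

/-- The primitive operations and tests of the processor, for every word size.  The injective `tag`
is the hidden padding that excludes collisions between runtime data and constants, and between
constants of different opcodes or positions. -/
structure InstructionSet (w : ℕ) where
  Op : Type
  Rel : Type
  eval : Op → ∀ n, BitVec n → BitVec n → BitVec n
  test : Rel → ∀ n, BitVec n → BitVec n → Bool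
  eval_poly : ∀ θ, PolySizeComputable fun n x y => wordBits (eval θ n x y)
  test_poly : ∀ R, PolySizeComputable fun n x y => [test R n x y]
  tag : WordKind Op Rel → BitVec w
  tag_injective : Function.Injective tag

variable {w : ℕ}

/-- Nominal machine code, for `L` locations (registers and memory) and `m` instructions.
Program point `m` is the end of the program. -/
inductive Instr (I : InstructionSet w) (n L m : ℕ) : Type
  /-- `r₀ ← (r₁ θ r₂) + v` -/
  | op (θ : I.Op) (r₀ r₁ r₂ : Fin L) (v : BitVec n)
  /-- `r₀ ← r₁` -/
  | move (r₀ r₁ : Fin L)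
  /-- if `r₁ R r₂` then go to `j` -/
  | branch (R : I.Rel) (r₁ r₂ : Fin L) (j : Fin (m + 1))
  /-- go to `j` -/
  | jump (j : Fin (m + 1))

/-- Machine code for encrypted computing, here with the embedded constants in plaintext. -/
inductive ObjInstr (I : InstructionSet w) (n L m : ℕ) : Type
  /-- `r₀ ← ((r₁ - k₁) θ (r₂ - k₂)) + k₀` -/
  | op (θ : I.Op) (r₀ r₁ r₂ : Fin L) (k₀ k₁ k₂ : BitVec n)
  /-- `r₀ ← r₁` -/
  | move (r₀ r₁ : Fin L)
  /-- if `(r₁ - k₁) R (r₂ - k₂)` then go to `j` -/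
  | branch (R : I.Rel) (r₁ r₂ : Fin L) (j : Fin (m + 1)) (k₁ k₂ : BitVec n)
  /-- go to `j` -/
  | jump (j : Fin (m + 1))

/-- The state of the processor: the program point and the content of the locations. -/
structure Config (n L m : ℕ) where
  pc : Fin (m + 1)
  store : Fin L → BitVec n

/-- One step of a nominal instruction at program point `a`. -/
def Instr.step {I : InstructionSet w} {n L m : ℕ} (a : Fin m) (s : Fin L → BitVec n) :
    Instr I n L m → Config n L m
  | .op θ r₀ r₁ r₂ v => ⟨a.succ, Function.update s r₀ (I.eval θ n (s r₁) (s r₂) + v)⟩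
  | .move r₀ r₁ => ⟨a.succ, Function.update s r₀ (s r₁)⟩
  | .branch R r₁ r₂ j => ⟨if I.test R n (s r₁) (s r₂) then j else a.succ, s⟩
  | .jump j => ⟨j, s⟩

/-- One step, beneath the encryption, of an instruction with embedded constants. -/
def ObjInstr.step {I : InstructionSet w} {n L m : ℕ} (a : Fin m) (s : Fin L → BitVec n) :
    ObjInstr I n L m → Config n L m
  | .op θ r₀ r₁ r₂ k₀ k₁ k₂ =>
      ⟨a.succ, Function.update s r₀ (I.eval θ n (s r₁ - k₁) (s r₂ - k₂) + k₀)⟩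
  | .move r₀ r₁ => ⟨a.succ, Function.update s r₀ (s r₁)⟩
  | .branch R r₁ r₂ j k₁ k₂ =>
      ⟨if I.test R n (s r₁ - k₁) (s r₂ - k₂) then j else a.succ, s⟩
  | .jump j => ⟨j, s⟩

/-- The embedded constants of an instruction as plaintexts, with their tags. -/
def ObjInstr.constants {I : InstructionSet w} {n L m : ℕ} :
    ObjInstr I n L m → List (BitVec w × BitVec n)
  | .op θ _ _ _ k₀ k₁ k₂ =>
      [(I.tag (.opConst θ 0), k₀), (I.tag (.opConst θ 1), k₁), (I.tag (.opConst θ 2), k₂)]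
  | .branch R _ _ _ k₁ k₂ => [(I.tag (.relConst R 0), k₁), (I.tag (.relConst R 1), k₂)]
  | _ => []

/-- A nominal machine code program for `n`-bit words. -/
structure Program (I : InstructionSet w) (n : ℕ) where
  locs : ℕ
  len : ℕ
  code : Fin len → Instr I n locs len

namespace Program

variable {I : InstructionSet w} {n : ℕ} (P : Program I n)

/-- The nominal configuration after `t` steps on input data `d`. -/
def nominalRun (d : Fin P.locs → BitVec n) : ℕ → Config n P.locs P.len
  | 0 => ⟨0, d⟩
  | t + 1 =>
      let c := nominalRun d t
      if h : c.pc.val < P.len then (P.code ⟨c.pc, h⟩).step ⟨c.pc, h⟩ c.store else c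

/-- An obfuscation scheme: an offset from nominal for every location at every program point. -/
abbrev Scheme := Fin (P.len + 1) → Fin P.locs → BitVec n

/-- The condition that an instruction at `a` imposes on an obfuscation scheme: the offsets at `a`
and at each next point agree in every location that is not written, a copy preserves data
exactly, and the offset of the result of an arithmetic instruction is free. -/
def Respects (D : P.Scheme) (a : Fin P.len) : Prop :=
  match P.code a with
  | .op _ r₀ _ _ _ => ∀ l, l ≠ r₀ → D a.succ l = D a.castSucc l
  | .move r₀ r₁ =>
      D a.succ r₀ = D a.castSucc r₁ ∧ ∀ l, l ≠ r₀ → D a.succ l = D a.castSucc l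
  | .branch _ _ _ j => D a.succ = D a.castSucc ∧ D j = D a.castSucc
  | .jump j => D j = D a.castSucc

/-- A scheme that every instruction respects; so offsets agree where control paths join. -/
def Consistent (D : P.Scheme) : Prop := ∀ a, P.Respects D a

theorem consistent_zero : P.Consistent 0 := by
  intro a
  unfold Respects
  split <;> simp

instance : Nonempty {D : P.Scheme // P.Consistent D} := ⟨⟨0, P.consistent_zero⟩⟩

open scoped Classical in
/-- The compiler's choice: all consistent obfuscation schemes are equally probable. -/
noncomputable def randomScheme : PMF {D : P.Scheme // P.Consistent D} :=
  PMF.uniformOfFintype _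

/-- The chaotically compiled code: the constants implement the obfuscation scheme. -/
def compile (D : P.Scheme) (a : Fin P.len) : ObjInstr I n P.locs P.len :=
  match P.code a with
  | .op θ r₀ r₁ r₂ v =>
      .op θ r₀ r₁ r₂ (v + D a.succ r₀) (D a.castSucc r₁) (D a.castSucc r₂)
  | .move r₀ r₁ => .move r₀ r₁
  | .branch R r₁ r₂ j => .branch R r₁ r₂ j (D a.castSucc r₁) (D a.castSucc r₂)
  | .jump j => .jump j

/-- The input data as encoded for the compiled code. -/
def compileInput (D : P.Scheme) (d : Fin P.locs → BitVec n) : Fin P.locs → BitVec n :=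
  d + D 0

/-- The configuration, beneath the encryption, of the compiled code on the compiled input data
after `t` steps. -/
def compiledRun (D : P.Scheme) (d : Fin P.locs → BitVec n) : ℕ → Config n P.locs P.len
  | 0 => ⟨0, P.compileInput D d⟩
  | t + 1 =>
      let c := compiledRun D d t
      if h : c.pc.val < P.len then (P.compile D ⟨c.pc, h⟩).step ⟨c.pc, h⟩ c.store else c

/-- The compiled code follows the nominal control flow, with every content offset from nominal as
the scheme says. -/
theorem compiledRun_eq {D : P.Scheme} (hD : P.Consistent D) (d : Fin P.locs → BitVec n) (t : ℕ) :
    P.compiledRun D d t =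
      ⟨(P.nominalRun d t).pc, (P.nominalRun d t).store + D (P.nominalRun d t).pc⟩ := by
  induction t with
  | zero => rfl
  | succ t ih =>
    rw [compiledRun, nominalRun, ih]
    generalize P.nominalRun d t = c
    obtain ⟨pc, s⟩ := c
    by_cases h : pc.val < P.len
    · have hc := hD ⟨pc, h⟩
      simp only [h, dif_pos]
      unfold Respects at hc
      unfold compile
      have e : (⟨pc.val, h⟩ : Fin P.len).castSucc = pc := rfl
      rw [e] at hc ⊢
      cases hi : P.code ⟨pc, h⟩ with
      | op θ r₀ r₁ r₂ v =>
        rw [hi] at hc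
        simp only [Fin.succ_mk] at hc
        simp only [Instr.step, ObjInstr.step, Config.mk.injEq, true_and]
        funext l
        by_cases hl : l = r₀
        · subst hl; simp [add_assoc]
        · simp [hl, hc l hl]
      | move r₀ r₁ =>
        rw [hi] at hc
        simp only [Fin.succ_mk] at hc
        simp only [Instr.step, ObjInstr.step, Config.mk.injEq, true_and]
        funext l
        by_cases hl : l = r₀
        · subst hl; simp [hc.1]
        · simp [hl, hc.2 l hl]
      | branch R r₁ r₂ j =>
        rw [hi] at hc
        simp only [Fin.succ_mk] at hc
        simp only [Instr.step, ObjInstr.step, Pi.add_apply, add_sub_cancel_right]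
        split <;> simp [hc.1, hc.2]
      | jump j =>
        rw [hi] at hc
        simp only at hc
        simp [Instr.step, ObjInstr.step, hc]
    · simp [h]

/-- The plaintexts that the operator meets, encrypted, on looking at the initial content of a
location or at the code at an address. -/
def itemPlains (D : P.Scheme) (d : Fin P.locs → BitVec n) :
    Fin P.locs ⊕ Fin P.len → List (BitVec w × BitVec n)
  | .inl l => [(I.tag .data, P.compileInput D d l)]
  | .inr a => (P.compile D a).constants

end Program

/-! ### The platform and the operator -/

/-- How the operator may interfere: with words that it has observed (copied, moved, transplanted
or substituted for one another), or with arbitrary words of its own making. -/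
inductive Interference : Type
  | observed
  | arbitrary

section Platform

variable (E : Encryption w) (I : InstructionSet w) (n : ℕ) (k : E.Key n)

open scoped Classical in
/-- The plaintext that the platform finds beneath a word supplied by the operator. -/
noncomputable def plainOf (μ : Interference) (issued : List (BitVec (E.ctLen n)))
    (c : BitVec (E.ctLen n)) : Option (BitVec w × BitVec n) :=
  match μ with
  | .observed => if c ∈ issued then E.dec n k c else none
  | .arbitrary => E.dec n k c

open scoped Classical in
/-- The content of a supplied word, if the platform finds it to be of the right kind. -/
noncomputable def contentOf (μ : Interference) (issued : List (BitVec (E.ctLen n)))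
    (κ : WordKind I.Op I.Rel) (c : BitVec (E.ctLen n)) : Option (BitVec n) :=
  (plainOf E n k μ issued c).bind fun m => if m.1 = I.tag κ then some m.2 else none

/-- The platform executes single instructions for the operator, who supplies the opcode, the
encrypted constants and the encrypted operands, in this order.  An arithmetic instruction returns
an encrypted result, a test returns the bit that decides the branch.  If a supplied word is not of
the right kind, the result is random nonsense.  The state is the list of ciphertexts that the
operator has been shown. -/
noncomputable def platform (μ : Interference) :
    I.Op ⊕ I.Rel → List Bool → List (BitVec (E.ctLen n)) →
      PMF (List Bool × List (BitVec (E.ctLen n)))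
  | .inl θ, q, issued =>
      let x (κ : WordKind I.Op I.Rel) (i : ℕ) : Option (BitVec n) :=
        contentOf E I n k μ issued κ (readWord (E.ctLen n) (i * E.ctLen n) q)
      let result : PMF (BitVec n) :=
        match x (.opConst θ 0) 0, x (.opConst θ 1) 1, x (.opConst θ 2) 2, x .data 3, x .data 4 with
        | some k₀, some k₁, some k₂, some x₁, some x₂ =>
            PMF.pure (I.eval θ n (x₁ - k₁) (x₂ - k₂) + k₀)
        | _, _, _, _, _ => PMF.uniformOfFintype (BitVec n)
      result.bind fun y =>
        (E.enc n k (I.tag .data, y)).map fun c => (wordBits c, c :: issued)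
  | .inr R, q, issued =>
      let x (κ : WordKind I.Op I.Rel) (i : ℕ) : Option (BitVec n) :=
        contentOf E I n k μ issued κ (readWord (E.ctLen n) (i * E.ctLen n) q)
      let result : PMF Bool :=
        match x (.relConst R 0) 0, x (.relConst R 1) 1, x .data 2, x .data 3 with
        | some k₁, some k₂, some x₁, some x₂ => PMF.pure (I.test R n (x₁ - k₁) (x₂ - k₂))
        | _, _, _, _ => PMF.uniformOfFintype Bool
      result.map fun b => ([b], issued)

/-- Encrypts a list of plaintexts, each with fresh randomness. -/
noncomputable def encryptAll : List (BitVec w × BitVec n) → PMF (List (BitVec (E.ctLen n)))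
  | [] => PMF.pure []
  | m :: ms => (E.enc n k m).bind fun c => (encryptAll ms).map fun cs => c :: cs

end Platform

/-- An operator.  For each word size it fixes the nominal program and input data, the locations
and code addresses at which it looks, and the circuit that, from the ciphertexts found there and by
experiments on the platform, computes its output. -/
structure Operator (I : InstructionSet w) where
  prog : ∀ n, Program I n
  input : ∀ n, Fin (prog n).locs → BitVec n
  view : ∀ n, List (Fin (prog n).locs ⊕ Fin (prog n).len)
  circuit : ℕ → OracleCircuit (I.Op ⊕ I.Rel)

namespace Operator

variable {I : InstructionSet w} (A : Operator I) (E : Encryption w)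

/-- The operator works in time polynomial in the word size.  The program itself may be longer. -/
def PolyTime : Prop :=
  PolyBounded (fun n => (A.view n).length) ∧ PolyBounded (fun n => (A.circuit n).size)

/-- What there is at the end of the game. -/
structure Outcome (n : ℕ) where
  key : E.Key n
  scheme : (A.prog n).Scheme
  output : List Bool
  issued : List (BitVec (E.ctLen n))

/-- The game: a key is drawn, the program and the data are chaotically compiled and encrypted, and
the operator examines, runs and interferes with the encrypted code and data. -/
noncomputable def game (μ : Interference) (n : ℕ) : PMF (A.Outcome E n) :=
  (E.gen n).bind fun k =>
    (A.prog n).randomScheme.bind fun D =>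
      (encryptAll E n k ((A.view n).flatMap ((A.prog n).itemPlains D.1 (A.input n)))).bind fun cs =>
        ((A.circuit n).run (platform E I n k μ) (cs.flatMap wordBits) cs).map fun r =>
          ⟨k, D.1, r.1, r.2⟩

/-- The operator's output is the attribute `φ` of the plaintext value beneath the encryption in
location `r` after `t` steps of the compiled program. -/
def discovers {n : ℕ} (t : ℕ) (r : Fin (A.prog n).locs) (φ : BitVec n → List Bool) :
    Set (A.Outcome E n) :=
  {o | o.output = φ (((A.prog n).compiledRun o.scheme (A.input n) t).store r)}

/-- The operator's output is an encrypted data word followed by the plaintext value beneath it. -/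
def alters (μ : Interference) {n : ℕ} : Set (A.Outcome E n) :=
  {o | contentOf E I n o.key μ o.issued .data (readWord (E.ctLen n) 0 o.output) =
    some (readWord n (E.ctLen n) o.output)}

end Operator

/-- The best chance of being right about the attribute `φ` of a uniformly random `n`-bit word
without any information: the largest proportion of words that share an attribute. -/
noncomputable def chance {n : ℕ} (φ : BitVec n → List Bool) : ℝ :=
  ((Finset.univ.sup fun y : BitVec n => (Finset.univ.filter fun x => φ x = φ y).card : ℕ) : ℝ)
    / 2 ^ n

/-- Encrypted computing resists polynomial-time attacks on the runtime data: no polynomial-time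
operator discovers the plaintext value at a point in the trace, or an attribute of it, nor exhibits
an encrypted data word with known plaintext, with probability non-negligibly above chance. -/
def ResistsAttacks (E : Encryption w) (I : InstructionSet w) (μ : Interference) : Prop :=
  ∀ A : Operator I, A.PolyTime →
    (∀ (t : ℕ → ℕ) (r : ∀ n, Fin (A.prog n).locs) (φ : ∀ n, BitVec n → List Bool),
      ∃ ε : ℕ → ℝ, Negligible ε ∧
        ∀ n, prob (A.game E μ n) (A.discovers E (t n) (r n) (φ n)) ≤ chance (φ n) + ε n) ∧
    (∃ ε : ℕ → ℝ, Negligible ε ∧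
      ∀ n, prob (A.game E μ n) (A.alters E μ) ≤ 1 / 2 ^ n + ε n)

/-!
A uniformly random scheme stays uniformly random when the same word `δ` is added to all of its
offsets, and then every content of the store and every constant of the code moves by `δ`, every
result of an instruction moves by `δ` and every branch decision stays as it was. So the game for
the scheme `D + δ` is a play against the platform of the scheme `D`, except that each word `m` that
should be encrypted is replaced by `m + δ` first. Left-or-right security allows encrypting `m`
itself instead, and then nothing the operator sees depends on `δ`: its output is as good as chosen
before `δ`, and it is right with no more than the probability of chance.

The adversary against the encryption plays the platform for the operator. It keeps a table of the
ciphertexts issued so far and of the words beneath them, so it never needs to decrypt, and it looks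
ciphertexts up with circuits of `nand` gates. A best pair of `D` and `δ` is built into its circuit,
for each word size separately.

An unrestricted operator sees the same answers as a restricted one until it supplies a valid
ciphertext that it was not issued, and the adversary that guesses at which gate and in which
position this happens is a forger.
-/

section Wires

variable {ws : List Bool} {i : ℕ}

theorem wire_append_left (h : i < ws.length) (z : List Bool) : wire (ws ++ z) i = wire ws i := by
  simp [wire, List.getElem?_append, h]

theorem wire_append_right (ws z : List Bool) (i : ℕ) :
    wire (ws ++ z) (ws.length + i) = wire z i := by
  simp [wire, List.getElem?_append]

theorem wire_eq_false (h : ws.length ≤ i) : wire ws i = false := by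
  simp [wire, h]

theorem map_wire_append {L : List ℕ} (h : ∀ i ∈ L, i < ws.length) (z : List Bool) :
    L.map (wire (ws ++ z)) = L.map (wire ws) :=
  List.map_congr_left fun i hi => wire_append_left (h i hi) z

theorem map_wire_range (ws : List Bool) : (List.range ws.length).map (wire ws) = ws := by
  apply List.ext_getElem <;> simp +contextual [wire]

theorem map_wire_range' (ws z : List Bool) :
    (List.range' ws.length z.length).map (wire (ws ++ z)) = z := by
  rw [List.range'_eq_map_range, List.map_map]
  exact (List.map_congr_left fun i _ => wire_append_right ws z i).trans (map_wire_range z)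

end Wires

/-- The values of all wires after a list of NAND gates. -/
def nandRun (gs : List (ℕ × ℕ)) (ws : List Bool) : List Bool :=
  gs.foldl (fun ws g => ws ++ [!(wire ws g.1 && wire ws g.2)]) ws

theorem nandRun_append (gs hs : List (ℕ × ℕ)) (ws : List Bool) :
    nandRun (gs ++ hs) ws = nandRun hs (nandRun gs ws) :=
  List.foldl_append

theorem nandRun_eq_append (gs : List (ℕ × ℕ)) (ws : List Bool) :
    ∃ z, nandRun gs ws = ws ++ z ∧ z.length = gs.length := by
  induction gs generalizing ws with
  | nil => exact ⟨[], by simp [nandRun]⟩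
  | cons g gs ih =>
    obtain ⟨z, hz, hlen⟩ := ih (ws ++ [!(wire ws g.1 && wire ws g.2)])
    exact ⟨[!(wire ws g.1 && wire ws g.2)] ++ z, by rw [← List.append_assoc, ← hz]; rfl,
      by simp [hlen]⟩

theorem length_nandRun (gs : List (ℕ × ℕ)) (ws : List Bool) :
    (nandRun gs ws).length = ws.length + gs.length := by
  obtain ⟨z, hz, hlen⟩ := nandRun_eq_append gs ws
  rw [hz, List.length_append, hlen]

theorem map_wire_nandRun {ws : List Bool} {L : List ℕ} (h : ∀ i ∈ L, i < ws.length)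
    (gs : List (ℕ × ℕ)) : L.map (wire (nandRun gs ws)) = L.map (wire ws) := by
  obtain ⟨z, hz, -⟩ := nandRun_eq_append gs ws
  rw [hz, map_wire_append h]

/-- The `b` bits `g x` can be computed from the `a` bits `f x` by `s` NAND gates, wherever these
are plugged into a larger circuit: `N` is the number of wires that exist already, and `ins` lists
those that carry `f x`. -/
def Computes {α : Type*} (a b s : ℕ) (f g : α → List Bool) : Prop :=
  ∀ (N : ℕ) (ins : List ℕ), ins.length = a → (∀ i ∈ ins, i < N) →
    ∃ (gs : List (ℕ × ℕ)) (out : List ℕ), gs.length ≤ s ∧ out.length = b ∧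
      (∀ i ∈ out, i < N + gs.length) ∧
      ∀ ws x, ws.length = N → ins.map (wire ws) = f x → out.map (wire (nandRun gs ws)) = g x

namespace Computes

variable {α : Type*} {a b c s t u : ℕ} {f g h : α → List Bool}

theorem mono (hg : Computes a b s f g) (hst : s ≤ t) : Computes a b t f g := by
  intro N ins hins hN
  obtain ⟨gs, out, hs, hout⟩ := hg N ins hins hN
  exact ⟨gs, out, hs.trans hst, hout⟩

theorem congr (hg : Computes a b s f g) (hgh : ∀ x, (f x).length = a → g x = h x) :
    Computes a b s f h := by
  intro N ins hins hN
  obtain ⟨gs, out, hs, hb, hout, hval⟩ := hg N ins hins hN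
  refine ⟨gs, out, hs, hb, hout, fun ws x hws hx => ?_⟩
  rw [hval ws x hws hx, hgh x (by rw [← hx, List.length_map, hins])]

theorem comp {β : Type*} (hg : Computes a b s f g) (φ : β → α) :
    Computes a b s (fun y => f (φ y)) fun y => g (φ y) := by
  intro N ins hins hN
  obtain ⟨gs, out, hs, hb, hout, hval⟩ := hg N ins hins hN
  exact ⟨gs, out, hs, hb, hout, fun ws y => hval ws (φ y)⟩

theorem trans (hg : Computes a b s f g) (hh : Computes b c t g h) :
    Computes a c (s + t) f h := by
  intro N ins hins hN
  obtain ⟨gs, mid, hs, hb, hmid, hval⟩ := hg N ins hins hN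
  obtain ⟨gs', out, ht, hc, hout, hval'⟩ := hh (N + gs.length) mid hb hmid
  refine ⟨gs ++ gs', out, by simp only [List.length_append]; omega, hc,
    by simpa [add_assoc] using hout, fun ws x hws hx => ?_⟩
  rw [nandRun_append, hval' _ x (by rw [length_nandRun, hws]) (hval ws x hws hx)]

theorem append (hg : Computes a b s f g) (hh : Computes a c t f h) :
    Computes a (b + c) (s + t) f fun x => g x ++ h x := by
  intro N ins hins hN
  obtain ⟨gs, out, hs, hb, hout, hval⟩ := hg N ins hins hN
  obtain ⟨gs', out', ht, hc, hout', hval'⟩ := hh (N + gs.length) ins hins fun i hi =>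
    (hN i hi).trans_le (Nat.le_add_right _ _)
  refine ⟨gs ++ gs', out ++ out', by simp only [List.length_append]; omega, by simp [hb, hc],
    fun i hi => ?_, fun ws x hws hx => ?_⟩
  · rw [List.length_append]
    rcases List.mem_append.1 hi with hi | hi
    · exact (hout i hi).trans_le (by omega)
    · exact (hout' i hi).trans_le (by omega)
  · subst hws
    have hlen : (nandRun gs ws).length = ws.length + gs.length := length_nandRun gs ws
    rw [List.map_append, nandRun_append, map_wire_nandRun (by simpa [hlen] using hout),
      hval ws x rfl hx, hval' _ x hlen (by rw [map_wire_nandRun hN, hx])]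

theorem refl (f : α → List Bool) : Computes a a 0 f f := fun _ ins hins hN =>
  ⟨[], ins, le_rfl, hins, hN, fun _ _ _ hx => hx⟩

theorem nil (f : α → List Bool) : Computes a 0 0 f fun _ => [] := fun _ _ _ _ =>
  ⟨[], [], le_rfl, rfl, by simp, fun _ _ _ _ => rfl⟩

theorem left (hg : ∀ x, (g x).length = a) : Computes (a + b) a 0 (fun x => g x ++ h x) g :=
  fun _ ins hins hN => ⟨[], ins.take a, le_rfl, by simp [hins],
    fun i hi => hN i (List.mem_of_mem_take hi),
    fun ws x _ hx => by rw [List.map_take, ← hg x]; exact hx ▸ List.take_left⟩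

theorem right (hg : ∀ x, (g x).length = a) : Computes (a + b) b 0 (fun x => g x ++ h x) h :=
  fun _ ins hins hN => ⟨[], ins.drop a, le_rfl, by simp [hins],
    fun i hi => hN i (List.mem_of_mem_drop hi),
    fun ws x _ hx => by rw [List.map_drop, ← hg x]; exact hx ▸ List.drop_left⟩

theorem const (f : α → List Bool) {l : List Bool} (hl : l.length = b) :
    Computes a b 2 f fun _ => l := by
  intro N ins _ _
  refine ⟨[(N, N), (N, N)], l.map fun b => if b then N else N + 1, le_rfl, by simpa using hl,
    fun i hi => ?_, fun ws x hws _ => ?_⟩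
  · obtain ⟨b, -, rfl⟩ := List.mem_map.1 hi
    cases b <;> simp
  · subst hws
    -- wire `N` does not exist yet at the first gate, so it carries `false`
    have hrun : nandRun [(ws.length, ws.length), (ws.length, ws.length)] ws =
        ws ++ [true, false] := by
      simp [nandRun, wire]
    rw [List.map_map, hrun]
    refine (List.map_congr_left fun b _ => ?_).trans l.map_id
    cases b <;> simp [wire]

theorem bit (f : α → List Bool) (i : ℕ) : Computes a 1 2 f fun x => [wire (f x) i] := by
  by_cases hi : i < a
  · intro N ins hins hN
    refine ⟨[], [ins[i]], by simp, rfl, by simpa using hN _ (List.getElem_mem _), ?_⟩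
    rintro ws x - hx
    simp [← hx, wire, nandRun, hins, hi]
  · exact (const f (l := [false]) rfl).congr fun x hx => by rw [wire_eq_false (by omega)]

theorem of_bits (hg : ∀ x, (g x).length = b)
    (H : ∀ i < b, Computes a 1 s f fun x => [wire (g x) i]) : Computes a b (b * s) f g := by
  have hprefix : ∀ k ≤ b, Computes a k (k * s) f fun x => (List.range k).map (wire (g x)) := by
    intro k hk
    induction k with
    | zero => simpa using nil f
    | succ k ih =>
      rw [Nat.succ_mul]
      refine ((ih (by omega)).append (H k (by omega))).congr fun x _ => ?_
      rw [List.range_succ, List.map_append, List.map_singleton]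
  exact (hprefix b le_rfl).congr fun x _ => by rw [← hg x, map_wire_range]

theorem wires (f : α → List Bool) (L : List ℕ) :
    Computes a L.length (L.length * 2) f fun x => L.map (wire (f x)) :=
  of_bits (fun x => List.length_map _) fun i hi => (bit f L[i]).congr fun x _ => by
    simp [wire, hi]

section Bits

variable {p q r : α → Bool}

theorem nand (hp : Computes a 1 s f fun x => [p x]) (hq : Computes a 1 t f fun x => [q x]) :
    Computes a 1 (s + t + 1) f fun x => [!(p x && q x)] := by
  refine (hp.append hq).trans fun N ins hins _ => ?_
  obtain ⟨i, j, rfl⟩ := List.length_eq_two.1 hins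
  refine ⟨[(i, j)], [N], le_rfl, rfl, by simp, fun ws x hws hx => ?_⟩
  subst hws
  obtain ⟨hi, hj⟩ : wire ws i = p x ∧ wire ws j = q x := by simpa using hx
  rw [← hi, ← hj]
  simp [nandRun, wire]

theorem bitIte (hp : Computes a 1 s f fun x => [p x]) (hq : Computes a 1 t f fun x => [q x])
    (hr : Computes a 1 u f fun x => [r x]) :
    Computes a 1 (3 * s + t + u + 4) f fun x => [if p x then q x else r x] :=
  (((hp.nand hq).nand ((hp.nand hp).nand hr)).mono (by omega)).congr fun x _ => by
    cases p x <;> simp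

theorem bool₂ (hp : Computes a 1 s f fun x => [p x]) (hq : Computes a 1 t f fun x => [q x])
    (φ : Bool → Bool → Bool) : Computes a 1 (s + t + 20) f fun x => [φ (p x) (q x)] := by
  have hconst (b : Bool) : Computes 2 1 2 (fun x => [p x] ++ [q x]) fun _ => [b] :=
    const _ rfl
  have hfst : Computes (1 + 1) 1 0 (fun x => [p x] ++ [q x]) fun x => [p x] :=
    left fun _ => rfl
  have hsnd : Computes (1 + 1) 1 0 (fun x => [p x] ++ [q x]) fun x => [q x] :=
    right fun _ => rfl
  refine (hp.append hq).trans (((hfst.bitIte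
    (hsnd.bitIte (hconst (φ true true)) (hconst (φ true false)))
    (hsnd.bitIte (hconst (φ false true)) (hconst (φ false false)))).mono (by omega)).congr
      fun x _ => ?_)
  cases p x <;> cases q x <;> rfl

end Bits

theorem all {p : ℕ → α → Bool} {m : ℕ} (H : ∀ i < m, Computes a 1 s f fun x => [p i x]) :
    Computes a 1 (m * (s + 20) + 2) f fun x => [(List.range m).all fun i => p i x] := by
  induction m with
  | zero => exact (const f (l := [true]) rfl).mono (by omega)
  | succ m ih =>
    refine (((ih fun i hi => H i (by omega)).bool₂ (H m (by omega)) (· && ·)).mono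
      (by rw [Nat.succ_mul]; omega)).congr fun x _ => ?_
    simp [List.range_succ]

theorem listEq (hg : Computes a b s f g) (hh : Computes a b t f h)
    (lg : ∀ x, (g x).length = b) (lh : ∀ x, (h x).length = b) :
    Computes a 1 (s + t + (b * 44 + 2)) f fun x => [decide (g x = h x)] := by
  refine (hg.append hh).trans ((all fun i _ => (bit _ i).bool₂ (bit _ (b + i)) (· == ·)).congr
    fun x _ => ?_)
  congr 1
  rw [Bool.eq_iff_iff, List.all_eq_true, decide_eq_true_eq]
  have hbits : ∀ i < b, (wire (g x ++ h x) i == wire (g x ++ h x) (b + i)) =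
      (wire (g x) i == wire (h x) i) := fun i hi => by
    rw [wire_append_left (by rwa [lg]), ← lg x, wire_append_right]
  constructor
  · intro H
    rw [← map_wire_range (g x), ← map_wire_range (h x), lg, lh]
    refine List.map_congr_left fun i hi => ?_
    rw [← beq_iff_eq, ← hbits i (List.mem_range.1 hi), H i hi]
  · intro H i hi
    rw [hbits i (List.mem_range.1 hi), H, beq_self_eq_true]

theorem ite {p : α → Bool} (hp : Computes a 1 s f fun x => [p x])
    (hg : Computes a b t f g) (hh : Computes a b u f h)
    (lg : ∀ x, (g x).length = b) (lh : ∀ x, (h x).length = b) :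
    Computes a b (s + (t + u) + b * 14) f fun x => if p x then g x else h x := by
  refine (hp.append (hg.append hh)).trans (of_bits (fun x => by split <;> simp [lg, lh])
    fun i hi => ((bit _ 0).bitIte (bit _ (1 + i)) (bit _ (1 + (b + i)))).congr fun x _ => ?_)
  have hwire (j : ℕ) : wire ([p x] ++ (g x ++ h x)) (1 + j) = wire (g x ++ h x) j :=
    wire_append_right [p x] _ j
  have hleft : wire (g x ++ h x) i = wire (g x) i := wire_append_left (by rwa [lg]) _
  have hright : wire (g x ++ h x) (b + i) = wire (h x) i := by rw [← lg x, wire_append_right]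
  have hcond : wire ([p x] ++ (g x ++ h x)) 0 = p x := rfl
  rw [hwire, hwire, hleft, hright, hcond]
  cases p x <;> rfl

theorem nandRun (f : α → List Bool) (gs : List (ℕ × ℕ)) :
    Computes a (a + gs.length) (gs.length * 5) f fun x => nandRun gs (f x) := by
  induction gs using List.reverseRecOn with
  | nil => exact refl f
  | append_singleton gs g ih =>
    rw [List.length_append, List.length_singleton, Nat.succ_mul, ← add_assoc]
    refine (ih.trans ((refl _).append ((bit _ g.1).nand (bit _ g.2)))).congr fun x _ => ?_
    rw [nandRun_append]
    rfl

theorem circuit (f : α → List Bool) (C : LogicCircuit) :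
    Computes a C.out.length (C.size * 5) f fun x => C.eval (f x) :=
  ((nandRun f C.gates).trans (wires _ C.out)).mono (by rw [LogicCircuit.size]; omega)

end Computes

section WordBits

variable {n : ℕ}

theorem length_wordBits (x : BitVec n) : (wordBits x).length = n := by
  simp [wordBits]

theorem wire_wordBits (x : BitVec n) (i : ℕ) : wire (wordBits x) i = x.getLsbD i := by
  by_cases h : i < n
  · simp [wire, wordBits, h]
  · rw [wire_eq_false (by rw [length_wordBits]; omega), BitVec.getLsbD_of_ge _ _ (by omega)]

theorem wordBits_injective : Function.Injective (wordBits (n := n)) := by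
  intro x y h
  apply BitVec.eq_of_getLsbD_eq
  intro i _
  rw [← wire_wordBits, ← wire_wordBits, h]

theorem getLsbD_readWord (off : ℕ) (s : List Bool) {i : ℕ} (h : i < n) :
    (readWord n off s).getLsbD i = wire s (off + i) := by
  simp [readWord, wire, h]

theorem readWord_append {off : ℕ} {s : List Bool} (hs : s.length = off) (x : BitVec n)
    (z : List Bool) : readWord n off (s ++ (wordBits x ++ z)) = x := by
  apply BitVec.eq_of_getLsbD_eq
  intro i hi
  rw [getLsbD_readWord _ _ hi, ← hs, wire_append_right,
    wire_append_left (by rwa [length_wordBits]), wire_wordBits]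

theorem wordBits_readWord (n off : ℕ) (s : List Bool) :
    wordBits (readWord n off s) = (List.range' off n).map (wire s) := by
  apply List.ext_getElem
  · simp [length_wordBits]
  · intro i hi _
    rw [length_wordBits] at hi
    have hbit := wire_wordBits (readWord n off s) i
    rw [getLsbD_readWord _ _ hi] at hbit
    simpa [wire, length_wordBits, hi] using hbit

end WordBits

/-- The number of gates that suffice for adding two words. -/
def addCost (n : ℕ) : ℕ := n * (n * 88 + 46)

/-- The number of gates that suffice for subtracting two words. -/
def subCost (n : ℕ) : ℕ := 2 * addCost n + n * 5 + 2

namespace Computes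

variable {α : Type*} {a s t n : ℕ} {f : α → List Bool}

theorem readWord (f : α → List Bool) (n off : ℕ) :
    Computes a n (n * 2) f fun x => wordBits (readWord n off (f x)) := by
  have hbits := wires (a := a) f (List.range' off n)
  rw [List.length_range'] at hbits
  exact hbits.congr fun x _ => (wordBits_readWord _ _ _).symm

theorem bitOf {x : α → BitVec n} (hx : Computes a n s f fun v => wordBits (x v)) (i : ℕ) :
    Computes a 1 (s + 2) f fun v => [(x v).getLsbD i] :=
  hx.trans ((bit _ i).congr fun v _ => by rw [wire_wordBits])

theorem of_getLsbD {x : α → BitVec n}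
    (H : ∀ i < n, Computes a 1 s f fun v => [(x v).getLsbD i]) :
    Computes a n (n * s) f fun v => wordBits (x v) :=
  of_bits (fun _ => length_wordBits _) fun i hi => (H i hi).congr fun v _ => by rw [wire_wordBits]

theorem carry {x y : α → BitVec n} (hx : Computes a n 0 f fun v => wordBits (x v))
    (hy : Computes a n 0 f fun v => wordBits (y v)) (i : ℕ) :
    Computes a 1 (i * 88 + 2) f fun v => [BitVec.carry i (x v) (y v) false] := by
  induction i with
  | zero => exact (const f (l := [false]) rfl).congr fun v _ => by simp
  | succ i ih =>
    have hxi := hx.bitOf i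
    have hyi := hy.bitOf i
    refine ((((hxi.bool₂ hyi (· || ·)).bool₂ ih (· && ·)).bool₂ (hxi.bool₂ hyi (· && ·))
      (· || ·)).mono (by omega)).congr fun v _ => ?_
    rw [BitVec.carry_succ]
    generalize (x v).getLsbD i = b, (y v).getLsbD i = c, BitVec.carry i (x v) (y v) false = d
    revert b c d
    decide

theorem add {x y : α → BitVec n} (hx : Computes a n s f fun v => wordBits (x v))
    (hy : Computes a n t f fun v => wordBits (y v)) :
    Computes a n (s + t + addCost n) f fun v => wordBits (x v + y v) := by
  refine (hx.append hy).trans (of_getLsbD fun i hi => ?_)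
  have hx' : Computes (n + n) n 0 (fun v => wordBits (x v) ++ wordBits (y v))
      fun v => wordBits (x v) := left fun _ => length_wordBits _
  have hy' : Computes (n + n) n 0 (fun v => wordBits (x v) ++ wordBits (y v))
      fun v => wordBits (y v) := right fun _ => length_wordBits _
  refine (((hx'.bitOf i).bool₂ ((hy'.bitOf i).bool₂ (carry hx' hy' i) Bool.xor) Bool.xor).mono
    (by omega)).congr fun v _ => ?_
  rw [BitVec.getLsbD_add hi]

theorem complement {x : α → BitVec n} (hx : Computes a n s f fun v => wordBits (x v)) :
    Computes a n (s + n * 5) f fun v => wordBits (~~~(x v)) := by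
  refine hx.trans (of_getLsbD fun i hi => ?_)
  have hxi := (refl fun v => wordBits (x v)).bitOf i
  exact (hxi.nand hxi).congr fun v _ => by simp [hi]

theorem sub {x y : α → BitVec n} (hx : Computes a n s f fun v => wordBits (x v))
    (hy : Computes a n t f fun v => wordBits (y v)) :
    Computes a n (s + t + subCost n) f fun v => wordBits (x v - y v) :=
  ((hx.add (hy.complement.add (const f (length_wordBits 1#n)))).mono
    (by rw [subCost]; omega)).congr fun v _ => by
      rw [BitVec.sub_eq_add_neg, BitVec.neg_eq_not_add]

theorem wordEq {x y : α → BitVec n} (hx : Computes a n s f fun v => wordBits (x v))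
    (hy : Computes a n t f fun v => wordBits (y v)) :
    Computes a 1 (s + t + (n * 44 + 2)) f fun v => [decide (x v = y v)] :=
  (hx.listEq hy (fun _ => length_wordBits _) fun _ => length_wordBits _).congr fun v _ => by
    simp only [wordBits_injective.eq_iff]

end Computes

section OptionBits

variable {β γ δ : Type*} [Inhabited β] [Inhabited γ] [Inhabited δ]

/-- An optional value as a bit string: a bit that says whether the value is there, and the encoding
`e` of the value, or that of `default` if it is absent. -/
def optionBits (e : β → List Bool) (o : Option β) : List Bool :=
  [o.isSome] ++ e (o.getD default)

theorem length_optionBits {b : ℕ} {e : β → List Bool} (he : ∀ y, (e y).length = b)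
    (o : Option β) : (optionBits e o).length = 1 + b := by
  rw [optionBits, List.length_append, he, List.length_singleton]

/-- The number of gates that suffice for applying an operation with a `b`-bit result, computed by
`c` gates, to two optional values. -/
def map₂Cost (b c : ℕ) : ℕ := c + b * 14 + 40

namespace Computes

variable {α : Type*} {a b c d r s t : ℕ} {f : α → List Bool} {e : β → List Bool}
  {e' : γ → List Bool} {e'' : δ → List Bool} {o : α → Option β} {o' : α → Option γ}

theorem isSome (ho : Computes a (1 + b) s f fun x => optionBits e (o x)) :
    Computes a 1 s f fun x => [(o x).isSome] :=
  ho.trans (left fun _ => rfl)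

theorem value (ho : Computes a (1 + b) s f fun x => optionBits e (o x)) :
    Computes a b s f fun x => e ((o x).getD default) :=
  ho.trans (right fun _ => rfl)

theorem getD (he : ∀ y, (e y).length = b)
    (ho : Computes a (1 + b) s f fun x => optionBits e (o x)) {u : α → β}
    (hu : Computes a b t f fun x => e (u x)) :
    Computes a b (2 * s + t + b * 14) f fun x => e ((o x).getD (u x)) :=
  ((ho.isSome.ite ho.value hu (fun _ => he _) fun _ => he _).mono (by omega)).congr
    fun x _ => by cases o x <;> rfl

theorem option_map₂ {F : β → γ → δ} (he : ∀ y, (e y).length = b) (he'' : ∀ y, (e'' y).length = d)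
    (hF : Computes (b + c) d r (fun v : β × γ => e v.1 ++ e' v.2) fun v => e'' (F v.1 v.2))
    (ho : Computes a (1 + b) s f fun x => optionBits e (o x))
    (ho' : Computes a (1 + c) t f fun x => optionBits e' (o' x)) :
    Computes a (1 + d) (s + t + map₂Cost d r) f
      fun x => optionBits e'' (Option.map₂ F (o x) (o' x)) := by
  refine (ho.append ho').trans ?_
  have hl : Computes (1 + b + (1 + c)) (1 + b) 0
      (fun x => optionBits e (o x) ++ optionBits e' (o' x)) fun x => optionBits e (o x) :=
    left fun _ => length_optionBits he _
  have hr : Computes (1 + b + (1 + c)) (1 + c) 0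
      (fun x => optionBits e (o x) ++ optionBits e' (o' x)) fun x => optionBits e' (o' x) :=
    right fun _ => length_optionBits he _
  refine (((hl.isSome.bool₂ hr.isSome (· && ·)).ite ((const _ (l := [true]) rfl).append
    ((hl.value.append hr.value).trans
      (hF.comp fun x => ((o x).getD default, (o' x).getD default))))
    (const _ (length_optionBits he'' none)) (fun _ => ?_) fun _ => length_optionBits he'' _).mono
    ?_).congr fun x _ => ?_
  · rw [List.length_append, he'', List.length_singleton]
  · simp only [map₂Cost, List.length_singleton]; omega
  · cases o x <;> cases o' x <;> rfl

end Computes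

end OptionBits

/-- A table of ciphertexts, each with a plaintext (padding, word). -/
abbrev Table (w ℓ n : ℕ) := List (BitVec ℓ × BitVec w × BitVec n)

/-- The bits of a plaintext, in the order in which `Encryption.readPlain` reads them. -/
def plainBits {n : ℕ} (m : BitVec w × BitVec n) : List Bool :=
  wordBits m.1 ++ wordBits m.2

/-- The bits of an entry of a table. -/
def entryBits {ℓ n : ℕ} (e : BitVec ℓ × BitVec w × BitVec n) : List Bool :=
  wordBits e.1 ++ plainBits e.2

/-- The bits of a table. -/
def tableBits {ℓ n : ℕ} (T : Table w ℓ n) : List Bool := T.flatMap entryBits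

/-- The word recorded in a table for the ciphertext `c` with the padding `g`. -/
def lookup {ℓ n : ℕ} (g : BitVec w) (c : BitVec ℓ) (T : Table w ℓ n) : Option (BitVec n) :=
  (T.find? fun e => decide (e.1 = c) && decide (e.2.1 = g)).map fun e => e.2.2

section

variable {ℓ n : ℕ}

theorem length_plainBits (m : BitVec w × BitVec n) : (plainBits m).length = w + n := by
  simp only [plainBits, List.length_append, length_wordBits]

theorem length_entryBits (e : BitVec ℓ × BitVec w × BitVec n) :
    (entryBits e).length = ℓ + (w + n) := by
  simp only [entryBits, List.length_append, length_wordBits, length_plainBits]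

theorem tableBits_cons (e : BitVec ℓ × BitVec w × BitVec n) (T : Table w ℓ n) :
    tableBits (e :: T) = entryBits e ++ tableBits T :=
  List.flatMap_cons

theorem lookup_cons (g : BitVec w) (c : BitVec ℓ) (e : BitVec ℓ × BitVec w × BitVec n)
    (T : Table w ℓ n) :
    lookup g c (e :: T) =
      if decide (e.1 = c) && decide (e.2.1 = g) then some e.2.2 else lookup g c T := by
  rw [lookup, List.find?_cons]
  split <;> simp_all [lookup]

theorem lookup_eq_none {g : BitVec w} {c : BitVec ℓ} {T : Table w ℓ n}
    (h : ∀ e ∈ T, e.1 = c → e.2.1 ≠ g) : lookup g c T = none := by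
  rw [lookup, List.find?_eq_none.2 fun e he => by simpa using h e he, Option.map_none]

theorem lookup_eq_some {g : BitVec w} {c : BitVec ℓ} {T : Table w ℓ n} {x : BitVec n}
    (hmem : ∃ e ∈ T, e.1 = c) (h : ∀ e ∈ T, e.1 = c → e.2 = (g, x)) :
    lookup g c T = some x := by
  obtain ⟨e, he, hc⟩ := hmem
  obtain ⟨e', he'⟩ := Option.isSome_iff_exists.1 <|
    (List.find?_isSome (p := fun e : BitVec ℓ × BitVec w × BitVec n =>
      decide (e.1 = c) && decide (e.2.1 = g))).2 ⟨e, he, by simp [hc, h e he hc]⟩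
  have hmatch := List.find?_some he'
  simp only [Bool.and_eq_true, decide_eq_true_eq] at hmatch
  rw [lookup, he', Option.map_some, h e' (List.mem_of_find?_eq_some he') hmatch.1]

theorem readPlain_append {off : ℕ} {s : List Bool} (hs : s.length = off)
    (m : BitVec w × BitVec n) (z : List Bool) :
    Encryption.readPlain w n off (s ++ (plainBits m ++ z)) = m := by
  refine Prod.ext ?_ ?_
  · rw [plainBits, List.append_assoc]
    exact readWord_append hs m.1 _
  · have hlen : (s ++ wordBits m.1).length = off + w := by
      rw [List.length_append, hs, length_wordBits]
    simpa only [Encryption.readPlain, plainBits, List.append_assoc] using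
      readWord_append hlen m.2 z

end

/-- The number of gates that suffice to look up a word in a table of `t` entries. -/
def lookupCost (w ℓ n t : ℕ) : ℕ := t * (ℓ * 44 + w * 44 + n * 14 + 44) + 2

namespace Computes

variable {α : Type*} {a s t u n ℓ : ℕ} {f : α → List Bool} {c : α → BitVec ℓ}
  {T : α → Table w ℓ n}

theorem lookup_of_entries (g : BitVec w) (hc : Computes a ℓ 0 f fun x => wordBits (c x))
    (hT : Computes a (t * (ℓ + (w + n))) 0 f fun x => tableBits (T x))
    (ht : ∀ x, (T x).length = t) :
    Computes a (1 + n) (lookupCost w ℓ n t) f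
      fun x => optionBits wordBits (lookup g (c x) (T x)) := by
  induction t generalizing T with
  | zero =>
    refine ((const f (length_optionBits length_wordBits none)).mono
      (by simp [lookupCost])).congr fun x _ => ?_
    rw [List.length_eq_zero_iff.1 (ht x)]
    rfl
  | succ t ih =>
    have hcons (x : α) : ∃ e T', T x = e :: T' ∧ T'.length = t := by
      obtain ⟨e, T', hx⟩ := List.exists_cons_of_length_eq_add_one (ht x)
      exact ⟨e, T', hx, by simpa [hx] using ht x⟩
    choose e T' hT' ht' using hcons
    rw [Nat.succ_mul, Nat.add_comm (t * _)] at hT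
    replace hT := hT.congr fun x _ => by rw [hT' x, tableBits_cons]
    have htail := hT.trans (right fun x => length_entryBits (e x))
    have hentry := hT.trans (left fun x => length_entryBits (e x))
    have hct := hentry.trans (left fun x => length_wordBits (e x).1)
    have hplain := hentry.trans (right fun x => length_wordBits (e x).1)
    have hpad := hplain.trans (left fun x => length_wordBits (e x).2.1)
    have hword := hplain.trans (right fun x => length_wordBits (e x).2.1)
    refine ((((hct.wordEq hc).bool₂ (hpad.wordEq (const f (length_wordBits g))) (· && ·)).ite
      ((const f (l := [true]) rfl).append hword) (ih htail ht')
      (fun x => ?_) fun x => length_optionBits length_wordBits _).mono ?_).congr fun x _ => ?_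
    · rw [List.length_append, length_wordBits, List.length_singleton]
    · simp only [lookupCost, List.length_singleton]
      rw [Nat.succ_mul]
      omega
    · rw [hT' x, lookup_cons]
      split <;> rfl

theorem lookup (g : BitVec w) (hc : Computes a ℓ s f fun x => wordBits (c x))
    (hT : Computes a (t * (ℓ + (w + n))) u f fun x => tableBits (T x))
    (ht : ∀ x, (T x).length = t) :
    Computes a (1 + n) (s + u + lookupCost w ℓ n t) f
      fun x => optionBits wordBits (lookup g (c x) (T x)) :=
  (hc.append hT).trans (lookup_of_entries g (left fun _ => length_wordBits _)
    (right fun _ => length_wordBits _) ht)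

end Computes

section Instructions

variable (I : InstructionSet w) {n ℓ : ℕ}

/-- The content of the supplied word at position `i`, if a table records it with kind `κ`. -/
def operand (κ : WordKind I.Op I.Rel) (i : ℕ) (q : List Bool) (T : Table w ℓ n) :
    Option (BitVec n) :=
  lookup (I.tag κ) (readWord ℓ (i * ℓ) q) T

/-- The data word at position `i` minus the constant of kind `κ` at position `j`, if a table
records both. -/
def difference (i : ℕ) (κ : WordKind I.Op I.Rel) (j : ℕ) (q : List Bool) (T : Table w ℓ n) :
    Option (BitVec n) :=
  Option.map₂ (· - ·) (operand I .data i q T) (operand I κ j q T)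

/-- The result of an arithmetic instruction on words recorded in a table, or `none` if a supplied
word is not recorded with the right kind. -/
def opValue (θ : I.Op) (q : List Bool) (T : Table w ℓ n) : Option (BitVec n) :=
  Option.map₂ (· + ·)
    (Option.map₂ (I.eval θ n) (difference I 3 (.opConst θ 1) 1 q T)
      (difference I 4 (.opConst θ 2) 2 q T))
    (operand I (.opConst θ 0) 0 q T)

/-- The result of a test on words recorded in a table, or `none` if a supplied word is not recorded
with the right kind. -/
def testValue (R : I.Rel) (q : List Bool) (T : Table w ℓ n) : Option Bool :=
  Option.map₂ (I.test R n) (difference I 2 (.relConst R 0) 0 q T)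
    (difference I 3 (.relConst R 1) 1 q T)

/-- The number of gates that suffice for an instruction on words recorded in a table of `t`
entries, for a query computed by `s` gates and an arithmetic unit of size `S`. -/
def instrCost (w ℓ n t s S : ℕ) : ℕ :=
  10 * (s + ℓ * 2 + lookupCost w ℓ n t) + 4 * subCost n + 2 * addCost n + 10 * S + n * 150 + 400

end Instructions

namespace Computes

variable {α : Type*} {a b s t u n ℓ S : ℕ} {f q : α → List Bool} {T : α → Table w ℓ n}
  (I : InstructionSet w)

theorem operand (hq : Computes a b s f q)
    (hT : Computes a (t * (ℓ + (w + n))) 0 f fun x => tableBits (T x))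
    (ht : ∀ x, (T x).length = t) (κ : WordKind I.Op I.Rel) (i : ℕ) :
    Computes a (1 + n) (s + ℓ * 2 + lookupCost w ℓ n t) f
      fun x => optionBits wordBits (operand I κ i (q x) (T x)) :=
  (lookup _ (hq.trans (readWord q ℓ (i * ℓ))) hT ht).mono (by omega)

theorem difference (hq : Computes a b s f q)
    (hT : Computes a (t * (ℓ + (w + n))) 0 f fun x => tableBits (T x))
    (ht : ∀ x, (T x).length = t) (i : ℕ) (κ : WordKind I.Op I.Rel) (j : ℕ) :
    Computes a (1 + n) (2 * (s + ℓ * 2 + lookupCost w ℓ n t) + map₂Cost n (subCost n)) f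
      fun x => optionBits wordBits (difference I i κ j (q x) (T x)) :=
  (option_map₂ length_wordBits length_wordBits
    (r := subCost n) ((sub (s := 0) (t := 0) (x := Prod.fst) (y := Prod.snd)
      (left fun v : BitVec n × BitVec n => length_wordBits v.1)
      (right fun v => length_wordBits v.1)).mono (by omega))
    (operand I hq hT ht .data i) (operand I hq hT ht κ j)).mono (by omega)

theorem unit {C : LogicCircuit} (hC : C.size ≤ S) {φ : BitVec n → BitVec n → List Bool}
    (hl : ∀ x y, (φ x y).length = b)
    (hφ : ∀ x y, C.eval (wordBits x ++ wordBits y) = φ x y) :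
    Computes (n + n) b (S * 5) (fun v : BitVec n × BitVec n => wordBits v.1 ++ wordBits v.2)
      fun v => φ v.1 v.2 := by
  have hb : C.out.length = b := by rw [← hl 0 0, ← hφ, LogicCircuit.eval, List.length_map]
  exact hb ▸ ((circuit _ C).mono (Nat.mul_le_mul_right 5 hC)).congr fun v _ => hφ v.1 v.2

theorem opResult {θ : I.Op} {C : LogicCircuit} (hC : C.size ≤ S)
    (hθ : ∀ x y, C.eval (wordBits x ++ wordBits y) = wordBits (I.eval θ n x y))
    (hq : Computes a b s f q)
    (hT : Computes a (t * (ℓ + (w + n))) 0 f fun x => tableBits (T x))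
    (ht : ∀ x, (T x).length = t) {y : α → BitVec n}
    (hy : Computes a n 0 f fun x => wordBits (y x)) :
    Computes a n (instrCost w ℓ n t s S) f
      fun x => wordBits ((opValue I θ (q x) (T x)).getD (y x)) := by
  have hsum := option_map₂ length_wordBits length_wordBits
    (add (x := Prod.fst) (y := Prod.snd) (left fun v : BitVec n × BitVec n => length_wordBits v.1)
      (right fun v => length_wordBits v.1))
    (option_map₂ length_wordBits length_wordBits
      (unit hC (fun _ _ => length_wordBits _) hθ) (difference I hq hT ht 3 (.opConst θ 1) 1)
      (difference I hq hT ht 4 (.opConst θ 2) 2))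
    (operand I hq hT ht (.opConst θ 0) 0)
  exact (hsum.getD length_wordBits hy).mono (by simp only [instrCost, map₂Cost]; omega)

theorem testResult {R : I.Rel} {C : LogicCircuit} (hC : C.size ≤ S)
    (hR : ∀ x y, C.eval (wordBits x ++ wordBits y) = [I.test R n x y])
    (hq : Computes a b s f q)
    (hT : Computes a (t * (ℓ + (w + n))) 0 f fun x => tableBits (T x))
    (ht : ∀ x, (T x).length = t) {y : α → Bool} (hy : Computes a 1 0 f fun x => [y x]) :
    Computes a 1 (instrCost w ℓ n t s S) f
      fun x => [(testValue I R (q x) (T x)).getD (y x)] := by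
  have hbit (b : Bool) : [b].length = 1 := rfl
  have htest := option_map₂ length_wordBits hbit
    (unit hC (fun _ _ => hbit _) hR) (difference I hq hT ht 2 (.relConst R 0) 0)
    (difference I hq hT ht 3 (.relConst R 1) 1)
  exact (htest.getD hbit hy).mono (by simp only [instrCost, map₂Cost]; omega)

end Computes

/-- Two distributions that no continuation respecting the relation `R` can tell apart. This is the
consequence of a coupling supported on `R` that matters for comparing probabilistic programs. -/
def Bisimilar {α β : Type} (R : α → β → Prop) (p : PMF α) (q : PMF β) : Prop :=
  ∀ ⦃γ : Type⦄ (Φ : α → PMF γ) (Ψ : β → PMF γ), (∀ a b, R a b → Φ a = Ψ b) →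
    p.bind Φ = q.bind Ψ

theorem bind_congr_support {α γ : Type} {p : PMF α} {Φ Ψ : α → PMF γ}
    (h : ∀ a ∈ p.support, Φ a = Ψ a) : p.bind Φ = p.bind Ψ := by
  ext y
  simp only [PMF.bind_apply]
  refine tsum_congr fun a => ?_
  by_cases ha : a ∈ p.support
  · rw [h a ha]
  · rw [(PMF.apply_eq_zero_iff p a).2 ha, zero_mul, zero_mul]

namespace Bisimilar

variable {α β γ δ : Type} {R : α → β → Prop} {S : γ → δ → Prop} {p : PMF α} {q : PMF β}

theorem pure {a : α} {b : β} (h : R a b) : Bisimilar R (PMF.pure a) (PMF.pure b) :=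
  fun _ Φ Ψ H => by rw [PMF.pure_bind, PMF.pure_bind, H a b h]

theorem refl (p : PMF α) : Bisimilar Eq p p := fun _ Φ Ψ H => by
  rw [funext fun a => H a a rfl]

theorem refl_support (p : PMF α) : Bisimilar (fun a b => a = b ∧ a ∈ p.support) p p :=
  fun _ _ _ H => bind_congr_support fun a ha => H a a ⟨rfl, ha⟩

theorem mono {R' : α → β → Prop} (H : Bisimilar R p q) (h : ∀ a b, R a b → R' a b) :
    Bisimilar R' p q :=
  fun _ Φ Ψ H' => H Φ Ψ fun a b hab => H' a b (h a b hab)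

theorem bind (H : Bisimilar R p q) {f : α → PMF γ} {g : β → PMF δ}
    (h : ∀ a b, R a b → Bisimilar S (f a) (g b)) : Bisimilar S (p.bind f) (q.bind g) :=
  fun _ Φ Ψ H' => by
    rw [PMF.bind_bind, PMF.bind_bind]
    exact H _ _ fun a b hab => h a b hab Φ Ψ H'

theorem map (H : Bisimilar R p q) {f : α → γ} {g : β → δ} (h : ∀ a b, R a b → S (f a) (g b)) :
    Bisimilar S (p.map f) (q.map g) :=
  H.bind fun a b hab => pure (h a b hab)

theorem map_eq (H : Bisimilar R p q) {f : α → γ} {g : β → γ} (h : ∀ a b, R a b → f a = g b) :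
    p.map f = q.map g :=
  H _ _ fun a b hab => congrArg PMF.pure (h a b hab)

theorem of_support {p : PMF α} {f : α → γ} {g : α → δ} (h : ∀ a ∈ p.support, S (f a) (g a)) :
    Bisimilar S (p.map f) (p.map g) :=
  (refl_support p).map fun a _ ha => ha.1 ▸ h a ha.2

end Bisimilar

/-- A word of `n + 1` bits, taken apart into its `n` low bits and its top bit. -/
def consEquiv (n : ℕ) : BitVec n × Bool ≃ BitVec (n + 1) where
  toFun p := p.1.cons p.2
  invFun x := (x.setWidth n, x.msb)
  left_inv p := by simp
  right_inv x := by simp [BitVec.cons_msb_setWidth]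

theorem wordBits_cons {n : ℕ} (x : BitVec n) (b : Bool) :
    wordBits (x.cons b) = wordBits x ++ [b] := by
  rw [wordBits, List.ofFn_succ_last]
  refine congrArg₂ _ (congrArg List.ofFn (funext fun i => ?_)) (congrArg (fun b => [b]) ?_)
  · simp [BitVec.getElem_cons, i.2.ne]
  · simp [BitVec.getElem_cons]

theorem uniformOfFintype_eq_bind {α β γ : Type} [Fintype α] [Nonempty α] [Fintype β] [Nonempty β]
    [Fintype γ] [Nonempty γ] (e : α × β ≃ γ) :
    PMF.uniformOfFintype γ = (PMF.uniformOfFintype α).bind fun a =>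
      (PMF.uniformOfFintype β).map fun b => e (a, b) := by
  classical
  ext y
  obtain ⟨⟨a, b⟩, rfl⟩ := e.surjective y
  simp only [PMF.bind_apply, PMF.map_apply, PMF.uniformOfFintype_apply, e.injective.eq_iff,
    Prod.mk.injEq, tsum_fintype, ite_and, ← Fintype.card_congr e, Fintype.card_prod]
  simp [ENNReal.mul_inv]

section RunGates

variable {κ σ : Type} (O : κ → List Bool → σ → PMF (List Bool × σ))

theorem runGates_append (gs hs : List (Gate κ)) (ws : List Bool) (s : σ) :
    runGates O (gs ++ hs) ws s = (runGates O gs ws s).bind fun r => runGates O hs r.1 r.2 := by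
  induction gs generalizing ws s with
  | nil => rw [List.nil_append, runGates, PMF.pure_bind]
  | cons g gs ih => cases g <;> simp only [List.cons_append, runGates, ih, PMF.bind_bind]

theorem runGates_nand (gs : List (ℕ × ℕ)) (ws : List Bool) (s : σ) :
    runGates O (gs.map fun g => Gate.nand g.1 g.2) ws s = PMF.pure (nandRun gs ws, s) := by
  induction gs generalizing ws with
  | nil => rfl
  | cons g gs ih => rw [List.map_cons, runGates, ih]; rfl

theorem sum_cost_nand (gs : List (ℕ × ℕ)) :
    ((gs.map fun g => (Gate.nand g.1 g.2 : Gate κ)).map Gate.cost).sum = gs.length := by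
  simp [Function.comp_def, Gate.cost]

end RunGates

/-- A run of gates from the wires `ws` has ended in the state and with the value of `y`: `ws` is
continued to `M` wires, and the wires `out` carry the encoding `g` of the value. -/
def Carries {β σ : Type} (ws : List Bool) (M : ℕ) (out : List ℕ) (g : β → List Bool)
    (r : List Bool × σ) (y : β × σ) : Prop :=
  ws <+: r.1 ∧ r.1.length = M ∧ out.map (wire r.1) = g y.1 ∧ r.2 = y.2

/-- The randomized procedure `X`, which has access to the state of an oracle, can be carried out on
encodings by gates of total cost `c`, wherever these are plugged into a larger circuit. The gates do
not depend on the index `i` of the oracle. -/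
def Realizes {ι κ σ α β : Type} (O : ι → κ → List Bool → σ → PMF (List Bool × σ)) (a b c : ℕ)
    (f : α → List Bool) (g : β → List Bool) (X : ι → α → σ → PMF (β × σ)) : Prop :=
  ∀ (N : ℕ) (ins : List ℕ), ins.length = a → (∀ j ∈ ins, j < N) →
    ∃ (gs : List (Gate κ)) (out : List ℕ) (M : ℕ), (gs.map Gate.cost).sum ≤ c ∧
      out.length = b ∧ (∀ j ∈ out, j < M) ∧
      ∀ i ws x s, ws.length = N → ins.map (wire ws) = f x →
        Bisimilar (Carries ws M out g) (runGates (O i) gs ws s) (X i x s)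

namespace Realizes

variable {ι κ σ α β γ : Type} {O : ι → κ → List Bool → σ → PMF (List Bool × σ)} {a b c d e : ℕ}
  {f : α → List Bool} {g : β → List Bool} {h : γ → List Bool} {X : ι → α → σ → PMF (β × σ)}
  {Y : ι → β → σ → PMF (γ × σ)}

theorem mono (H : Realizes O a b c f g X) (hcd : c ≤ d) : Realizes O a b d f g X := by
  intro N ins hins hN
  obtain ⟨gs, out, M, hc, hout⟩ := H N ins hins hN
  exact ⟨gs, out, M, hc.trans hcd, hout⟩

theorem congr (H : Realizes O a b c f g X) {X' : ι → α → σ → PMF (β × σ)}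
    (hX : ∀ i x s, X i x s = X' i x s) : Realizes O a b c f g X' := by
  rwa [show X' = X from funext fun i => funext fun x => funext fun s => (hX i x s).symm]

theorem of_computes {φ : α → β} (H : Computes a b c f fun x => g (φ x)) :
    Realizes O a b c f g fun _ x s => PMF.pure (φ x, s) := by
  intro N ins hins hN
  obtain ⟨gs, out, hc, hb, hout, hval⟩ := H N ins hins hN
  refine ⟨gs.map fun g => .nand g.1 g.2, out, N + gs.length, (sum_cost_nand gs).trans_le hc, hb,
    hout, fun i ws x s hws hx => ?_⟩
  rw [runGates_nand]
  obtain ⟨z, hz, -⟩ := nandRun_eq_append gs ws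
  exact .pure ⟨⟨z, hz.symm⟩, by rw [length_nandRun, hws], hval ws x hws hx, rfl⟩

theorem bind (H : Realizes O a b c f g X) (H' : Realizes O b e d g h Y) :
    Realizes O a e (c + d) f h fun i x s => (X i x s).bind fun r => Y i r.1 r.2 := by
  intro N ins hins hN
  obtain ⟨gs, mid, M, hc, hb, hmid, hval⟩ := H N ins hins hN
  obtain ⟨gs', out, M', hd, he, hout, hval'⟩ := H' M mid hb hmid
  refine ⟨gs ++ gs', out, M', by simpa using Nat.add_le_add hc hd, he, hout,
    fun i ws x s hws hx => ?_⟩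
  rw [runGates_append]
  refine (hval i ws x s hws hx).bind ?_
  rintro ⟨ws', s⟩ ⟨y, _⟩ ⟨hpre, hlen, hy, rfl⟩
  exact (hval' i ws' y s hlen hy).mono fun r z hz => ⟨hpre.trans hz.1, hz.2⟩

theorem trans {φ : β → γ} (H : Realizes O a b c f g X)
    (hφ : Computes b e d g fun y => h (φ y)) :
    Realizes O a e (c + d) f h fun i x s => (X i x s).map fun r => (φ r.1, r.2) :=
  H.bind (of_computes hφ)

theorem keep (H : Realizes O a b c f g X) :
    Realizes O a (a + b) c f (fun y : α × β => f y.1 ++ g y.2)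
      fun i x s => (X i x s).map fun r => ((x, r.1), r.2) := by
  intro N ins hins hN
  obtain ⟨gs, out, M, hc, hb, hout, hval⟩ := H N ins hins hN
  refine ⟨gs, ins ++ out, max N M, hc, by simp [hins, hb], fun j hj => lt_max_iff.2
    ((List.mem_append.1 hj).imp (hN j) (hout j)), fun i ws x s hws hx => ?_⟩
  rw [← PMF.map_id (runGates (O i) gs ws s)]
  refine (hval i ws x s hws hx).map ?_
  rintro ⟨_, s⟩ ⟨y, _⟩ ⟨⟨z, rfl⟩, hlen, hy, rfl⟩
  subst hws
  refine ⟨⟨z, rfl⟩, ?_, ?_, rfl⟩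
  · rw [max_eq_right (by rw [← hlen, List.length_append]; omega)]
    exact hlen
  · rw [List.map_append]
    exact congrArg₂ _ ((map_wire_append hN z).trans hx) hy

theorem coin (f : α → List Bool) : Realizes O a 1 1 f (fun b => [b]) fun _ _ s =>
    (PMF.uniformOfFintype Bool).map fun b => (b, s) := by
  intro N ins _ _
  refine ⟨[.coin], [N], N + 1, le_rfl, rfl, by simp, fun i ws x s hws _ => ?_⟩
  refine (Bisimilar.refl _).bind fun b _ hb => ?_
  subst hb hws
  exact .pure ⟨⟨[b], rfl⟩, by simp, by simp [wire], rfl⟩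

theorem ask {k : κ} (f : α → List Bool) (hg : ∀ y, (g y).length = b)
    (hX : ∀ i x s, O i k (f x) s = (X i x s).map fun r => (g r.1, r.2)) :
    Realizes O a b (1 + a) f g X := by
  intro N ins hins _
  refine ⟨[.ask k ins], List.range' N b, N + b, by simp [Gate.cost, hins], by simp,
    by simp, fun i ws x s hws hx => ?_⟩
  rw [runGates, hx, hX, PMF.bind_map]
  suffices H : Bisimilar (Carries ws (N + b) (List.range' N b) g) _ ((X i x s).bind PMF.pure) by
    rwa [PMF.bind_pure] at H
  refine (Bisimilar.refl (X i x s)).bind fun y _ hy => ?_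
  subst hy hws
  exact .pure ⟨⟨g y.1, rfl⟩, by simp [hg], by simpa only [hg] using map_wire_range' ws (g y.1),
    rfl⟩

theorem word (hf : ∀ x, (f x).length = a) (n : ℕ) : Realizes O a n n f wordBits fun _ _ s =>
    (PMF.uniformOfFintype (BitVec n)).map fun u => (u, s) := by
  induction n with
  | zero =>
    refine (of_computes (φ := fun _ => (0 : BitVec 0)) (Computes.nil f)).congr fun _ _ s => ?_
    rw [funext fun u : BitVec 0 => congrArg (fun u => (u, s)) (Subsingleton.elim u 0)]
    exact (PMF.map_const _ _).symm
  | succ n ih =>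
    have hcons : Computes (a + n + 1) (n + 1) 0
        (fun y : (α × BitVec n) × Bool => (f y.1.1 ++ wordBits y.1.2) ++ [y.2])
        fun y => wordBits (y.1.2.cons y.2) := by
      simp only [wordBits_cons, List.append_assoc, Nat.add_assoc]
      exact Computes.right fun y : (α × BitVec n) × Bool => hf y.1.1
    refine ((ih.keep.bind (coin _).keep).trans hcons).congr fun _ x s => ?_
    rw [uniformOfFintype_eq_bind (consEquiv n)]
    simp only [PMF.map_bind, PMF.bind_map, PMF.map_comp, Function.comp_def]
    rfl

theorem exists_circuit {f : Unit → List Bool} {X : ι → Unit → σ → PMF (β × σ)}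
    (H : Realizes O 0 b c f g X) (hf : f () = []) :
    ∃ C : OracleCircuit κ, C.size ≤ c + b ∧
      ∀ i s, C.run (O i) [] s = (X i () s).map fun r => (g r.1, r.2) := by
  obtain ⟨gs, out, M, hc, hb, -, hval⟩ := H 0 [] rfl (by simp)
  refine ⟨⟨gs, out⟩, Nat.add_le_add hc hb.le, fun i s => ?_⟩
  exact (hval i [] () s rfl hf.symm).map_eq fun r y hy => Prod.ext hy.2.2.1 hy.2.2.2

end Realizes

/-- A plaintext with its word moved by the offset `δ`. -/
def shift {n : ℕ} (δ : BitVec n) (m : BitVec w × BitVec n) : BitVec w × BitVec n :=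
  (m.1, m.2 + δ)

/-- The query that offers the plaintext `m` on the left and its shift on the right. -/
def shiftQuery {n : ℕ} (δ : BitVec n) (m : BitVec w × BitVec n) : List Bool :=
  plainBits m ++ plainBits (shift δ m)

namespace Computes

variable {α : Type*} {a s n : ℕ} {f : α → List Bool} {y : α → BitVec n}

theorem plainBits (hy : Computes a n s f fun x => wordBits (y x)) (g : BitVec w) :
    Computes a (w + n) (s + 2) f fun x => plainBits (g, y x) :=
  ((const f (length_wordBits g)).append hy).mono (by omega)

theorem shiftQuery (hy : Computes a n s f fun x => wordBits (y x)) (g : BitVec w)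
    (δ : BitVec n) :
    Computes a (w + n + (w + n)) (2 * s + addCost n + 6) f fun x => shiftQuery δ (g, y x) :=
  ((hy.plainBits g).append ((hy.add (const f (length_wordBits δ))).plainBits g)).mono (by omega)

end Computes

section TableGame

variable (I : InstructionSet w) {ℓ n : ℕ} {σ : Type}
  (enc : BitVec w × BitVec n → σ → PMF (BitVec ℓ × σ))

/-- A platform that knows the plaintexts beneath the ciphertexts it has issued only from a table,
and that encrypts its results by `enc`. The operations and tests are those of `platform`, with the
random nonsense drawn in advance. -/
noncomputable def tableOracle :
    I.Op ⊕ I.Rel → List Bool → Table w ℓ n × σ → PMF (List Bool × Table w ℓ n × σ)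
  | .inl θ, q, s => (PMF.uniformOfFintype (BitVec n)).bind fun u =>
      let m := (I.tag .data, (opValue I θ q s.1).getD u)
      (enc m s.2).map fun r => (wordBits r.1, (r.1, m) :: s.1, r.2)
  | .inr R, q, s => (PMF.uniformOfFintype Bool).map fun u =>
      ([(testValue I R q s.1).getD u], s)

/-- Encrypts a list of plaintexts and records them in a table. -/
noncomputable def encryptTable : List (BitVec w × BitVec n) → σ → PMF (Table w ℓ n × σ)
  | [], s => PMF.pure ([], s)
  | m :: ms, s => (encryptTable ms s).bind fun r =>
      (enc m r.2).map fun r' => ((r'.1, m) :: r.1, r'.2)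

/-- The bits of the ciphertexts in a table. -/
def cipherBits (T : Table w ℓ n) : List Bool := T.flatMap fun e => wordBits e.1

/-- The operator's circuit `C` at work on the encrypted plaintexts `ms` and a platform that keeps a
table. -/
noncomputable def tableGame (ms : List (BitVec w × BitVec n)) (C : OracleCircuit (I.Op ⊕ I.Rel))
    (s : σ) : PMF (List Bool × Table w ℓ n × σ) :=
  (encryptTable enc ms s).bind fun r => C.run (tableOracle I enc) (cipherBits r.1) r

end TableGame

/-- The operations and tests of the processor on `n`-bit words have circuits of size at most
`S`. -/
def UnitsBounded (I : InstructionSet w) (n S : ℕ) : Prop :=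
  (∀ θ, ∃ C : LogicCircuit, C.size ≤ S ∧
    ∀ x y, C.eval (wordBits x ++ wordBits y) = wordBits (I.eval θ n x y)) ∧
  ∀ R, ∃ C : LogicCircuit, C.size ≤ S ∧
    ∀ x y, C.eval (wordBits x ++ wordBits y) = [I.test R n x y]

/-- The oracles `O i` encrypt `m` as `enc i` does, on the query that offers `m` and its shift by
`δ`. -/
def Issues {ι σ : Type} {ℓ n : ℕ} (O : ι → Unit → List Bool → σ → PMF (List Bool × σ))
    (δ : BitVec n) (enc : ι → BitVec w × BitVec n → σ → PMF (BitVec ℓ × σ)) : Prop :=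
  ∀ i m s, O i () (shiftQuery δ m) s = (enc i m s).map fun r => (wordBits r.1, r.2)

/-- The state of a simulation of the operator's circuit: the values of its `v` wires, and a table of
`t` entries. -/
abbrev SimState (w ℓ n v t : ℕ) :=
  List.Vector Bool v × List.Vector (BitVec ℓ × BitVec w × BitVec n) t

namespace SimState

variable {ℓ n v t : ℕ}

/-- The wires that carry the state of a simulation. -/
def bits (x : SimState w ℓ n v t) : List Bool := x.1.toList ++ tableBits x.2.toList

/-- The state of the simulated circuit and its oracle. -/
def simulated {σ : Type} (r : SimState w ℓ n v t × σ) : List Bool × Table w ℓ n × σ :=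
  (r.1.1.toList, r.1.2.toList, r.2)

theorem length_tableBits_toList (T : List.Vector (BitVec ℓ × BitVec w × BitVec n) t) :
    (tableBits T.toList).length = t * (ℓ + (w + n)) := by
  simp [tableBits, List.length_flatMap, length_entryBits]

theorem length_bits (x : SimState w ℓ n v t) : (bits x).length = v + t * (ℓ + (w + n)) := by
  rw [bits, List.length_append, List.Vector.toList_length, length_tableBits_toList]

theorem computes_wires :
    Computes (v + t * (ℓ + (w + n))) v 0 (bits (w := w) (ℓ := ℓ) (n := n) (v := v) (t := t))
      fun x => x.1.toList :=
  Computes.left fun x => x.1.toList_length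

theorem computes_table :
    Computes (v + t * (ℓ + (w + n))) (t * (ℓ + (w + n))) 0
      (bits (w := w) (ℓ := ℓ) (n := n) (v := v) (t := t)) fun x => tableBits x.2.toList :=
  Computes.right fun x => x.1.toList_length

/-- The state after the reply `r`, which is recorded in the table by the entries `T`. -/
def extend (x : SimState w ℓ n v t) (r : List Bool) {b : ℕ} (hr : r.length = b)
    (T : Table w ℓ n) {c : ℕ} (hT : T.length = c) : SimState w ℓ n (v + b) (t + c) :=
  (⟨x.1.toList ++ r, by rw [List.length_append, x.1.toList_length, hr]⟩,
    ⟨T ++ x.2.toList, by rw [List.length_append, x.2.toList_length, hT, Nat.add_comm]⟩)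

theorem bits_extend (x : SimState w ℓ n v t) (r : List Bool) {b : ℕ} (hr : r.length = b)
    (T : Table w ℓ n) {c : ℕ} (hT : T.length = c) :
    bits (x.extend r hr T hT) = x.1.toList ++ r ++ (tableBits T ++ tableBits x.2.toList) := by
  simp [bits, extend, tableBits, List.Vector.toList]

end SimState

theorem Computes.extend {α : Type*} {ℓ n v t a b c d : ℕ} {f : α → List Bool}
    {x : α → SimState w ℓ n v t}
    (hx : Computes a (v + t * (ℓ + (w + n))) 0 f fun y => (x y).bits)
    {r : α → List Bool} (hr : ∀ y, (r y).length = b) {T : α → Table w ℓ n}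
    (hT : ∀ y, (T y).length = c)
    (hrT : Computes a (b + c * (ℓ + (w + n))) d f fun y => r y ++ tableBits (T y)) :
    Computes a (v + b + (t + c) * (ℓ + (w + n))) d f
      fun y => ((x y).extend (r y) (hr y) (T y) (hT y)).bits := by
  have hbits (y) : (x y).bits.length = v + t * (ℓ + (w + n)) := SimState.length_bits _
  have hold := Computes.left (b := b + c * (ℓ + (w + n)))
    (h := fun y => r y ++ tableBits (T y)) hbits
  have hnew := Computes.right (b := b + c * (ℓ + (w + n)))
    (h := fun y => r y ++ tableBits (T y)) hbits
  have hwires := hold.trans (SimState.computes_wires.comp x)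
  have htable := hold.trans (SimState.computes_table.comp x)
  rw [Nat.add_mul, Nat.add_comm (t * _)]
  refine (((hx.append hrT).trans ((hwires.append (hnew.trans (Computes.left hr))).append
    ((hnew.trans (Computes.right hr)).append htable))).mono (by omega)).congr fun y _ => ?_
  rw [SimState.bits_extend]

/-- The number of gates that suffice to simulate a gate of cost at most `c` of the operator's
circuit, with a table of at most `t` entries and arithmetic units of size at most `S`. -/
def gateCost (w ℓ n t c S : ℕ) : ℕ :=
  3 * instrCost w ℓ n t (c * 2) S + addCost n + 4 * (w + n) + 10

theorem gateCost_mono {w ℓ n t t' c c' S : ℕ} (ht : t ≤ t') (hc : c ≤ c') :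
    gateCost w ℓ n t c S ≤ gateCost w ℓ n t' c' S := by
  unfold gateCost instrCost lookupCost
  gcongr

theorem Realizes.issue {ι σ α : Type} {ℓ n a s : ℕ} {δ : BitVec n}
    {O : ι → Unit → List Bool → σ → PMF (List Bool × σ)}
    {enc : ι → BitVec w × BitVec n → σ → PMF (BitVec ℓ × σ)} (hO : Issues O δ enc)
    {f : α → List Bool} {y : α → BitVec n} (g : BitVec w)
    (hy : Computes a n s f fun x => wordBits (y x)) :
    Realizes O a ℓ (2 * s + addCost n + 2 * (w + n) + 7) f wordBits
      fun i x σ => enc i (g, y x) σ :=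
  (((of_computes (φ := fun x => (g, y x)) (hy.shiftQuery g δ)).bind
    (ask (shiftQuery δ) length_wordBits fun i m s => hO i m s)).mono (by omega)).congr
      fun _ _ _ => PMF.pure_bind _ _

/-- The gates `gs` of an operator's circuit, consulting a platform that keeps a table, can be
simulated by gates of total cost `c` that consult the oracles `O`, from `v` wires and `t` entries
on. -/
def Simulable {ι σ : Type} {ℓ n : ℕ} (I : InstructionSet w)
    (O : ι → Unit → List Bool → σ → PMF (List Bool × σ))
    (enc : ι → BitVec w × BitVec n → σ → PMF (BitVec ℓ × σ)) (v t c : ℕ)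
    (gs : List (Gate (I.Op ⊕ I.Rel))) : Prop :=
  ∃ (v' t' : ℕ) (X : ι → SimState w ℓ n v t → σ → PMF (SimState w ℓ n v' t' × σ)),
    t' ≤ t + gs.length ∧
    Realizes O (v + t * (ℓ + (w + n))) (v' + t' * (ℓ + (w + n))) c SimState.bits SimState.bits X ∧
    ∀ i x s, (X i x s).map SimState.simulated =
      runGates (tableOracle I (enc i)) gs x.1.toList (x.2.toList, s)

namespace Simulable

open SimState

variable {I : InstructionSet w} {ι σ β : Type} {ℓ n v t a b c d s S : ℕ} {δ : BitVec n}
  {O : ι → Unit → List Bool → σ → PMF (List Bool × σ)}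
  {enc : ι → BitVec w × BitVec n → σ → PMF (BitVec ℓ × σ)}

theorem of_reply {g : Gate (I.Op ⊕ I.Rel)} {f : β → List Bool}
    {Y : ι → SimState w ℓ n v t → σ → PMF (β × σ)}
    (H : Realizes O (v + t * (ℓ + (w + n))) a s bits f Y)
    {r : SimState w ℓ n v t × β → List Bool} (hr : ∀ y, (r y).length = b)
    {T : SimState w ℓ n v t × β → Table w ℓ n} (hT : ∀ y, (T y).length = c) (hc : c ≤ 1)
    (hrT : Computes (v + t * (ℓ + (w + n)) + a) (b + c * (ℓ + (w + n))) d
      (fun y => bits y.1 ++ f y.2) fun y => r y ++ tableBits (T y))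
    (hg : ∀ i x s, runGates (tableOracle I (enc i)) [g] x.1.toList (x.2.toList, s) =
      (Y i x s).map fun y =>
        (x.1.toList ++ r (x, y.1), T (x, y.1) ++ x.2.toList, y.2)) :
    Simulable I O enc v t (s + d) [g] := by
  have hlen (y : SimState w ℓ n v t × β) := length_bits y.1
  have hext := Computes.extend (Computes.left hlen) hr hT hrT
  refine ⟨v + b, t + c, _, Nat.add_le_add_left hc t,
    H.keep.trans (φ := fun y => y.1.extend (r y) (hr y) (T y) (hT y)) hext, fun i x s => ?_⟩
  rw [hg, PMF.map_comp, PMF.map_comp]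
  rfl

theorem mono {gs : List (Gate (I.Op ⊕ I.Rel))} (H : Simulable I O enc v t c gs) (hcd : c ≤ d) :
    Simulable I O enc v t d gs := by
  obtain ⟨v', t', X, ht', hX, hgs⟩ := H
  exact ⟨v', t', X, ht', hX.mono hcd, hgs⟩

theorem computes_query (L : List ℕ) :
    Computes (v + t * (ℓ + (w + n))) L.length (L.length * 2)
      (bits (w := w) (ℓ := ℓ) (n := n) (v := v) (t := t)) fun x => L.map (wire x.1.toList) :=
  (computes_wires.trans (Computes.wires _ L)).mono (by omega)

theorem of_bit {g : Gate (I.Op ⊕ I.Rel)} {f : β → List Bool}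
    {Y : ι → SimState w ℓ n v t → σ → PMF (β × σ)}
    (H : Realizes O (v + t * (ℓ + (w + n))) a s bits f Y) {p : SimState w ℓ n v t × β → Bool}
    (hp : Computes (v + t * (ℓ + (w + n)) + a) 1 d (fun y => bits y.1 ++ f y.2) fun y => [p y])
    (hg : ∀ i x s, runGates (tableOracle I (enc i)) [g] x.1.toList (x.2.toList, s) =
      (Y i x s).map fun y => (x.1.toList ++ [p (x, y.1)], x.2.toList, y.2)) :
    Simulable I O enc v t (s + d) [g] :=
  of_reply (b := 1) (c := 0) (T := fun _ => []) H (fun _ => rfl) (fun _ => rfl) (Nat.zero_le 1)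
    (by simpa [tableBits] using hp) hg

theorem nand (i j : ℕ) : Simulable I O enc v t 5 [.nand i j] := by
  have hdone : Realizes O (v + t * (ℓ + (w + n))) 0 0 bits (fun _ : Unit => [])
      fun _ (_ : SimState w ℓ n v t) s => PMF.pure ((), s) :=
    Realizes.of_computes (φ := fun _ => ()) (Computes.nil _)
  have hnand := (computes_wires (w := w) (ℓ := ℓ) (n := n) (v := v) (t := t)).trans
    ((Computes.bit _ i).nand (Computes.bit _ j))
  have hlen (y : SimState w ℓ n v t × Unit) := length_bits y.1
  refine of_bit hdone (((Computes.left hlen).trans (hnand.comp Prod.fst)).mono (t := 5)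
    (by omega)) fun i x s => ?_
  rw [PMF.pure_map]
  rfl

theorem coin : Simulable I O enc v t 1 [.coin] := by
  refine of_bit (Realizes.coin _) (Computes.right fun y => length_bits y.1) fun i x s => ?_
  simp only [PMF.map_comp, runGates]
  rfl

theorem op (hO : Issues O δ enc) (hS : UnitsBounded I n S) (θ : I.Op) (L : List ℕ) :
    Simulable I O enc v t
      (n + (2 * instrCost w ℓ n t (L.length * 2) S + addCost n + 2 * (w + n) + 7) +
        (instrCost w ℓ n t (L.length * 2) S + 2)) [.ask (.inl θ) L] := by
  obtain ⟨C, hC, hθ⟩ := hS.1 θ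
  have hlen (y : SimState w ℓ n v t × BitVec n) := length_bits y.1
  have hold := Computes.left (b := n) (h := fun y => wordBits y.2) hlen
  have hval := (Computes.opResult I hC hθ (hold.trans ((computes_query L).comp Prod.fst))
    (hold.trans (computes_table.comp Prod.fst)) (fun y => y.1.2.toList_length)
    (Computes.right hlen)).mono (t := instrCost w ℓ n t (L.length * 2) S) (by rw [Nat.zero_add])
  have hct := (Realizes.word (O := O) length_bits n).keep.bind
    (Realizes.issue hO (I.tag .data) hval).keep
  have hlen' (y : (SimState w ℓ n v t × BitVec n) × BitVec ℓ) :
      (bits y.1.1 ++ wordBits y.1.2).length = v + t * (ℓ + (w + n)) + n := by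
    rw [List.length_append, length_bits, length_wordBits]
  have hfirst := Computes.left (b := ℓ)
    (h := fun y : (SimState w ℓ n v t × BitVec n) × BitVec ℓ => wordBits y.2) hlen'
  have hct_bits := Computes.right (b := ℓ)
    (h := fun y : (SimState w ℓ n v t × BitVec n) × BitVec ℓ => wordBits y.2) hlen'
  have hentry := hct_bits.append (hct_bits.append (hfirst.trans
    ((hval.plainBits (I.tag .data)).comp Prod.fst)))
  have hstate (y : SimState w ℓ n v t × (SimState w ℓ n v t × BitVec n) × BitVec ℓ) :=
    length_bits y.1
  refine (of_reply hct (r := fun y => wordBits y.2.2) (fun y => length_wordBits y.2.2)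
    (T := fun y => [(y.2.2, I.tag .data,
      (opValue I θ (L.map (wire y.2.1.1.1.toList)) y.2.1.1.2.toList).getD y.2.1.2)])
    (fun _ => rfl) le_rfl (d := instrCost w ℓ n t (L.length * 2) S + 2)
    ?_ fun i x s => ?_).mono (by omega)
  · have hrT := (Computes.right hstate).trans (hentry.comp Prod.snd)
    simpa [tableBits, entryBits] using hrT
  · simp only [PMF.bind_map, PMF.map_comp, PMF.map_bind, runGates, tableOracle, PMF.bind_bind,
      Function.comp_def]
    rfl

theorem test (hS : UnitsBounded I n S) (R : I.Rel) (L : List ℕ) :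
    Simulable I O enc v t (1 + instrCost w ℓ n t (L.length * 2) S) [.ask (.inr R) L] := by
  obtain ⟨C, hC, hR⟩ := hS.2 R
  have hlen (y : SimState w ℓ n v t × Bool) := length_bits y.1
  have hold := Computes.left (b := 1) (h := fun y => [y.2]) hlen
  have hval := (Computes.testResult I hC hR (hold.trans ((computes_query L).comp Prod.fst))
    (hold.trans (computes_table.comp Prod.fst)) (fun y => y.1.2.toList_length)
    (Computes.right hlen)).mono (t := instrCost w ℓ n t (L.length * 2) S) (by rw [Nat.zero_add])
  refine of_bit (Realizes.coin _) hval fun i x s => ?_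
  simp only [PMF.map_comp, runGates, tableOracle, PMF.bind_map]
  rfl

theorem gate (hO : Issues O δ enc) (hS : UnitsBounded I n S) (g : Gate (I.Op ⊕ I.Rel)) :
    Simulable I O enc v t (gateCost w ℓ n t g.cost S) [g] := by
  have hquery (L : List ℕ) : instrCost w ℓ n t (L.length * 2) S ≤
      instrCost w ℓ n t ((1 + L.length) * 2) S := by
    unfold instrCost
    omega
  match g with
  | .nand i j => exact (nand i j).mono (by unfold gateCost; omega)
  | .coin => exact coin.mono (by unfold gateCost; omega)
  | .ask (.inl θ) L =>
    have := hquery L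
    exact (op hO hS θ L).mono (by rw [gateCost, Gate.cost]; omega)
  | .ask (.inr R) L =>
    have := hquery L
    exact (test hS R L).mono (by rw [gateCost, Gate.cost]; omega)

theorem nil : Simulable I O enc v t 0 [] :=
  ⟨v, t, _, le_rfl, Realizes.of_computes (φ := id) (Computes.refl bits), fun _ _ _ =>
    PMF.pure_map _ _⟩

theorem append {gs hs : List (Gate (I.Op ⊕ I.Rel))} (hgs : Simulable I O enc v t c gs)
    (hhs : ∀ v' t', t' ≤ t + gs.length → Simulable I O enc v' t' d hs) :
    Simulable I O enc v t (c + d) (gs ++ hs) := by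
  obtain ⟨v', t', X, ht', hX, hrun⟩ := hgs
  obtain ⟨v'', t'', Y, ht'', hY, hrun'⟩ := hhs v' t' ht'
  refine ⟨v'', t'', _, by rw [List.length_append]; omega, hX.bind hY, fun i x s => ?_⟩
  rw [PMF.map_bind, runGates_append, ← hrun, PMF.bind_map]
  exact congrArg _ (funext fun r => hrun' i r.1 r.2)

theorem gates (hO : Issues O δ enc) (hS : UnitsBounded I n S) (gs : List (Gate (I.Op ⊕ I.Rel))) :
    ∀ {v t : ℕ}, t + gs.length ≤ a → (∀ g ∈ gs, g.cost ≤ b) →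
      Simulable I O enc v t (gs.length * gateCost w ℓ n a b S) gs := by
  induction gs with
  | nil => exact fun _ _ => nil.mono (Nat.zero_le _)
  | cons g gs ih =>
    intro v t ha hb
    obtain ⟨hg, hgs⟩ := List.forall_mem_cons.1 hb
    rw [List.length_cons] at ha ⊢
    refine (((gate hO hS g).mono (gateCost_mono (t' := a) (by omega) hg)).append
      fun v' t' ht' => ih (by rw [List.length_singleton] at ht'; omega) hgs).mono
        (le_of_eq (by ring))

end Simulable

namespace SimState

variable {ℓ n v t : ℕ}

/-- The state before the run, with one more initial ciphertext. -/
def addInput (x : SimState w ℓ n v t) (m : BitVec w × BitVec n) (c : BitVec ℓ) :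
    SimState w ℓ n (ℓ + v) (t + 1) :=
  (⟨wordBits c ++ x.1.toList, by
      rw [List.length_append, length_wordBits, x.1.toList_length]⟩,
    (c, m) ::ᵥ x.2)

theorem computes_addInput (m : BitVec w × BitVec n) :
    Computes (v + t * (ℓ + (w + n)) + ℓ) (ℓ + v + (t + 1) * (ℓ + (w + n))) 2
      (fun y : SimState w ℓ n v t × BitVec ℓ => bits y.1 ++ wordBits y.2)
      fun y => bits (y.1.addInput m y.2) := by
  have hlen (y : SimState w ℓ n v t × BitVec ℓ) := length_bits y.1
  have hstate := Computes.left (b := ℓ) (h := fun y => wordBits y.2) hlen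
  have hct := Computes.right (b := ℓ) (h := fun y => wordBits y.2) hlen
  have hentry := hct.append (Computes.const
    (fun y : SimState w ℓ n v t × BitVec ℓ => bits y.1 ++ wordBits y.2) (length_plainBits m))
  have hrows : (t + 1) * (ℓ + (w + n)) = ℓ + (w + n) + t * (ℓ + (w + n)) := by ring
  rw [hrows]
  refine (((hct.append (hstate.trans (computes_wires.comp Prod.fst))).append
    (hentry.append (hstate.trans (computes_table.comp Prod.fst)))).mono (t := 2) (by omega)).congr
      fun y _ => ?_
  simp [bits, addInput, tableBits, entryBits]

end SimState

section TableGame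

open SimState

variable {I : InstructionSet w} {ι σ : Type} {ℓ n S : ℕ} {δ : BitVec n}
  {O : ι → Unit → List Bool → σ → PMF (List Bool × σ)}
  {enc : ι → BitVec w × BitVec n → σ → PMF (BitVec ℓ × σ)}

theorem realizes_encryptTable (hO : Issues O δ enc) (ms : List (BitVec w × BitVec n)) :
    ∃ (v : ℕ) (X : ι → Unit → σ → PMF (SimState w ℓ n v ms.length × σ)),
      Realizes O 0 (v + ms.length * (ℓ + (w + n)))
        (ms.length * (addCost n + 2 * (w + n) + 13)) (fun _ => []) bits X ∧
      ∀ i s, (X i () s).map simulated =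
        (encryptTable (enc i) ms s).map fun r => (cipherBits r.1, r.1, r.2) := by
  induction ms with
  | nil =>
    refine ⟨0, _, Realizes.of_computes (φ := fun _ => (List.Vector.nil, List.Vector.nil)) ?_,
      fun i s => ?_⟩
    · simpa [bits, tableBits] using Computes.nil _
    · rw [encryptTable, PMF.pure_map, PMF.pure_map]
      rfl
  | cons m ms ih =>
    obtain ⟨v, X, hX, hsim⟩ := ih
    have hissue := Realizes.issue hO (a := v + ms.length * (ℓ + (w + n)))
      (f := bits (w := w) (ℓ := ℓ) (n := n) (v := v) (t := ms.length)) m.1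
      (Computes.const _ (length_wordBits m.2))
    refine ⟨ℓ + v, _, ((hX.bind hissue.keep).trans (computes_addInput m)).mono
      (le_of_eq (by rw [List.length_cons]; ring)), fun i s => ?_⟩
    have hnext := congrArg (fun p => p.bind fun T => (enc i m T.2.2).map fun c =>
      (wordBits c.1 ++ T.1, (c.1, m) :: T.2.1, c.2)) (hsim i s)
    simp only [PMF.bind_map] at hnext
    simp only [encryptTable, PMF.map_bind, PMF.map_comp]
    exact hnext

theorem length_gates_le_size {κ : Type} (C : OracleCircuit κ) : C.gates.length ≤ C.size := by
  rw [OracleCircuit.size, ← List.length_map (f := Gate.cost)]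
  refine (List.length_le_sum_of_one_le _ fun c hc => ?_).trans (Nat.le_add_right _ _)
  obtain ⟨g, -, rfl⟩ := List.mem_map.1 hc
  cases g <;> simp [Gate.cost]

theorem cost_le_size {κ : Type} {C : OracleCircuit κ} {g : Gate κ} (hg : g ∈ C.gates) :
    g.cost ≤ C.size :=
  (List.single_le_sum (by simp) _ (List.mem_map_of_mem hg)).trans (Nat.le_add_right _ _)

/-- The number of gates that suffice to play the game of an operator's circuit of size `c` on `m`
initial ciphertexts, with arithmetic units of size `S`. -/
def simulatorCost (w ℓ n m c S : ℕ) : ℕ :=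
  m * (addCost n + 2 * (w + n) + 13) + c * gateCost w ℓ n (m + c) c S + c * 2

theorem exists_simulator (hO : Issues O δ enc) (hS : UnitsBounded I n S)
    (C : OracleCircuit (I.Op ⊕ I.Rel)) (ms : List (BitVec w × BitVec n)) {b d : ℕ}
    {h : List Bool → Table w ℓ n → List Bool}
    (hh : ∀ t ≤ ms.length + C.size, Computes (C.out.length + t * (ℓ + (w + n))) b d
      (bits (v := C.out.length) (t := t)) fun x => h x.1.toList x.2.toList) :
    ∃ C' : OracleCircuit Unit, C'.size ≤ simulatorCost w ℓ n ms.length C.size S + d + b ∧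
      ∀ i s, C'.run (O i) [] s =
        (tableGame I (enc i) ms C s).map fun r => (h r.1 r.2.1, r.2.2) := by
  have hgates := length_gates_le_size C
  obtain ⟨v, X, hX, hstart⟩ := realizes_encryptTable hO ms
  obtain ⟨v', t, Y, ht, hY, hgame⟩ := Simulable.gates hO hS C.gates (v := v) (t := ms.length)
    (Nat.add_le_add_left hgates _) fun g => cost_le_size
  let output (x : SimState w ℓ n v' t) : SimState w ℓ n C.out.length t :=
    (⟨C.out.map (wire x.1.toList), List.length_map _⟩, x.2)
  have hout := ((computes_wires.trans (Computes.wires _ C.out)).append computes_table).trans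
    ((hh t (by omega)).comp output)
  obtain ⟨C', hC', hrun⟩ := ((hX.bind hY).trans (h := id)
    (φ := fun x => h (output x).1.toList x.2.toList) hout).exists_circuit rfl
  refine ⟨C', hC'.trans ?_, fun i s => ?_⟩
  · have hsteps := Nat.mul_le_mul_right (gateCost w ℓ n (ms.length + C.size) C.size S) hgates
    have hwires : C.out.length ≤ C.size := Nat.le_add_left _ _
    rw [simulatorCost]
    omega
  · have hnext := congrArg (fun p => p.bind fun r => (runGates (tableOracle I (enc i)) C.gates
      r.1 r.2).map fun r => (h (C.out.map (wire r.1)) r.2.1, r.2.2)) (hstart i s)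
    simp only [PMF.bind_map, Function.comp_def] at hnext
    rw [hrun]
    simp only [tableGame, OracleCircuit.run, PMF.map_bind, PMF.map_comp]
    refine Eq.trans (congrArg _ (funext fun r => ?_)) hnext
    refine Eq.trans ?_ (congrArg (PMF.map _) (hgame i r.1 r.2))
    rw [PMF.map_comp]
    rfl

end TableGame

theorem uniformOfFintype_map_equiv {α β : Type} [Fintype α] [Nonempty α] [Fintype β] [Nonempty β]
    (e : α ≃ β) : (PMF.uniformOfFintype α).map e = PMF.uniformOfFintype β := by
  classical
  ext y
  obtain ⟨x, rfl⟩ := e.surjective y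
  simp [PMF.map_apply, tsum_fintype, Fintype.card_congr e]

theorem uniformOfFintype_map_getD {α : Type} [Fintype α] [Nonempty α] (o : Option α) :
    (PMF.uniformOfFintype α).map (fun u => o.getD u) =
      o.elim (PMF.uniformOfFintype α) PMF.pure := by
  cases o with
  | none => exact PMF.map_id _
  | some x => exact PMF.map_const _ x

section Bisimulation

variable {κ σ τ : Type} {O : κ → List Bool → σ → PMF (List Bool × σ)}
  {O' : κ → List Bool → τ → PMF (List Bool × τ)} {R : σ → τ → Prop}

/-- Two oracle interactions give the same bits and end in states related by `R`. -/
def SameBits (R : σ → τ → Prop) (r : List Bool × σ) (r' : List Bool × τ) : Prop :=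
  r.1 = r'.1 ∧ R r.2 r'.2

theorem bisimilar_runGates
    (hO : ∀ i q s s', R s s' → Bisimilar (SameBits R) (O i q s) (O' i q s'))
    (gs : List (Gate κ)) (ws : List Bool) {s : σ} {s' : τ} (hs : R s s') :
    Bisimilar (SameBits R) (runGates O gs ws s) (runGates O' gs ws s') := by
  induction gs generalizing ws s s' with
  | nil => exact .pure ⟨rfl, hs⟩
  | cons g gs ih =>
    cases g with
    | nand i j => exact ih _ hs
    | coin => exact (Bisimilar.refl _).bind fun b _ hb => hb ▸ ih _ hs
    | ask i q =>
      refine (hO i _ s s' hs).bind fun r r' hr => ?_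
      rw [hr.1]
      exact ih _ hr.2

theorem bisimilar_run
    (hO : ∀ i q s s', R s s' → Bisimilar (SameBits R) (O i q s) (O' i q s'))
    (C : OracleCircuit κ) (input : List Bool) {s : σ} {s' : τ} (hs : R s s') :
    Bisimilar (SameBits R) (C.run O input s) (C.run O' input s') :=
  (bisimilar_runGates hO C.gates input hs).map fun _ _ hr => ⟨by rw [hr.1], hr.2⟩

end Bisimulation

section ObservedPlatform

variable (E : Encryption w) (I : InstructionSet w) {n : ℕ} {k : E.Key n} {δ : BitVec n} {σ : Type}
  {Φ : List (BitVec (E.ctLen n)) → σ}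
  {enc : BitVec w × BitVec n → σ → PMF (BitVec (E.ctLen n) × σ)}

/-- The encryption `enc` encrypts the plaintexts moved by `δ`, and of the ciphertexts issued so far
it keeps what `Φ` says. -/
def EncryptsShifted (k : E.Key n) (δ : BitVec n) (Φ : List (BitVec (E.ctLen n)) → σ)
    (enc : BitVec w × BitVec n → σ → PMF (BitVec (E.ctLen n) × σ)) : Prop :=
  ∀ m cs, enc m (Φ cs) = (E.enc n k (shift δ m)).map fun c => (c, Φ (c :: cs))

/-- The table in `r` records the issued ciphertexts, with the plaintexts beneath them before the
move by `δ`. -/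
def Records (k : E.Key n) (δ : BitVec n) (Φ : List (BitVec (E.ctLen n)) → σ)
    (issued : List (BitVec (E.ctLen n))) (r : Table w (E.ctLen n) n × σ) : Prop :=
  r.1.map Prod.fst = issued ∧ r.2 = Φ issued ∧ ∀ e ∈ r.1, E.dec n k e.1 = some (shift δ e.2)

variable {E} {issued : List (BitVec (E.ctLen n))} {r : Table w (E.ctLen n) n × σ}

theorem shift_injective (δ : BitVec n) : Function.Injective (shift (w := w) δ) := fun m m' h => by
  simpa [shift, Prod.ext_iff] using h

theorem Records.cons (hr : Records E k δ Φ issued r) (hk : k ∈ (E.gen n).support)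
    {m : BitVec w × BitVec n} {c : BitVec (E.ctLen n)}
    (hc : c ∈ (E.enc n k (shift δ m)).support) :
    Records E k δ Φ (c :: issued) ((c, m) :: r.1, Φ (c :: issued)) :=
  ⟨congrArg (c :: ·) hr.1, rfl, List.forall_mem_cons.2 ⟨E.correct n k _ c hk hc, hr.2.2⟩⟩

theorem Records.cipherBits_eq (hr : Records E k δ Φ issued r) :
    cipherBits r.1 = issued.flatMap wordBits := by
  rw [← hr.1, List.flatMap_map, cipherBits]

theorem contentOf_observed (hr : Records E k δ Φ issued r) (κ : WordKind I.Op I.Rel)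
    (c : BitVec (E.ctLen n)) :
    contentOf E I n k .observed issued κ c = (lookup (I.tag κ) c r.1).map (· + δ) := by
  obtain ⟨rfl, -, hdec⟩ := hr
  by_cases hc : c ∈ r.1.map Prod.fst
  · obtain ⟨e, he, rfl⟩ := List.mem_map.1 hc
    have hsame : ∀ e' ∈ r.1, e'.1 = e.1 → e'.2 = e.2 := fun e' he' h =>
      shift_injective δ (Option.some_injective _ (by rw [← hdec e' he', ← hdec e he, h]))
    simp only [contentOf, plainOf, hc, if_true, hdec e he, Option.bind_some, shift]
    split
    · next htag =>
      rw [lookup_eq_some (x := e.2.2) ⟨e, he, rfl⟩ fun e' he' h => by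
        rw [hsame e' he' h, ← htag], Option.map_some]
    · next htag =>
      rw [lookup_eq_none fun e' he' h => by rwa [hsame e' he' h], Option.map_none]
  · rw [lookup_eq_none fun e he h => (hc (List.mem_map.2 ⟨e, he, h⟩)).elim]
    simp [contentOf, plainOf, hc]

theorem platform_observed_op (hr : Records E k δ Φ issued r) (θ : I.Op) (q : List Bool) :
    platform E I n k .observed (.inl θ) q issued =
      (PMF.uniformOfFintype (BitVec n)).bind fun u =>
        (E.enc n k (shift δ (I.tag .data, (opValue I θ q r.1).getD u))).map fun c =>
          (wordBits c, c :: issued) := by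
  have hresult : ((opValue I θ q r.1).map (· + δ)).elim
      (PMF.uniformOfFintype (BitVec n)) PMF.pure =
      (PMF.uniformOfFintype (BitVec n)).map fun u => (opValue I θ q r.1).getD u + δ := by
    cases opValue I θ q r.1 with
    | none => exact (uniformOfFintype_map_equiv (Equiv.addRight δ)).symm
    | some x => exact (PMF.map_const _ (x + δ)).symm
  refine Eq.trans ?_ (congrArg (fun p => p.bind fun y =>
    (E.enc n k (I.tag .data, y)).map fun c => (wordBits c, c :: issued)) hresult) |>.trans ?_
  · simp only [platform, contentOf_observed I hr, opValue, difference, operand]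
    congr 1
    generalize lookup _ (readWord _ (0 * _) q) _ = k₀
    generalize lookup _ (readWord _ (1 * _) q) _ = k₁
    generalize lookup _ (readWord _ (2 * _) q) _ = k₂
    generalize lookup _ (readWord _ (3 * _) q) _ = x₁
    generalize lookup _ (readWord _ (4 * _) q) _ = x₂
    cases k₀ <;> cases k₁ <;> cases k₂ <;> cases x₁ <;> cases x₂ <;>
      simp [add_assoc]
  · rw [PMF.bind_map]
    rfl

theorem platform_observed_test (hr : Records E k δ Φ issued r) (R : I.Rel) (q : List Bool) :
    platform E I n k .observed (.inr R) q issued =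
      (PMF.uniformOfFintype Bool).map fun u => ([(testValue I R q r.1).getD u], issued) := by
  refine Eq.trans ?_ ((congrArg (PMF.map fun b => ([b], issued))
    (uniformOfFintype_map_getD (testValue I R q r.1))).symm.trans (PMF.map_comp _ _ _))
  simp only [platform, contentOf_observed I hr, testValue, difference, operand]
  congr 1
  generalize lookup _ (readWord _ (0 * _) q) _ = k₁
  generalize lookup _ (readWord _ (1 * _) q) _ = k₂
  generalize lookup _ (readWord _ (2 * _) q) _ = x₁
  generalize lookup _ (readWord _ (3 * _) q) _ = x₂
  cases k₁ <;> cases k₂ <;> cases x₁ <;> cases x₂ <;> simp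

theorem bisimilar_platform_tableOracle (henc : EncryptsShifted E k δ Φ enc)
    (hk : k ∈ (E.gen n).support) (i : I.Op ⊕ I.Rel) (q : List Bool)
    (hr : Records E k δ Φ issued r) :
    Bisimilar (SameBits (Records E k δ Φ)) (platform E I n k .observed i q issued)
      (tableOracle I enc i q r) := by
  cases i with
  | inl θ =>
    rw [platform_observed_op I hr, tableOracle]
    refine (Bisimilar.refl _).bind fun u _ hu => hu ▸ ?_
    dsimp only
    rw [hr.2.1, henc, PMF.map_comp]
    exact .of_support fun c hc => ⟨rfl, hr.cons hk hc⟩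
  | inr R =>
    rw [platform_observed_test I hr, tableOracle]
    exact .of_support fun u _ => ⟨rfl, hr⟩

theorem bisimilar_encryptAll_encryptTable (henc : EncryptsShifted E k δ Φ enc)
    (hk : k ∈ (E.gen n).support) (ms : List (BitVec w × BitVec n)) :
    Bisimilar (Records E k δ Φ) (encryptAll E n k (ms.map (shift δ)))
      (encryptTable enc ms (Φ [])) := by
  induction ms with
  | nil => exact .pure ⟨rfl, rfl, by simp⟩
  | cons m ms ih =>
    have hswap : encryptAll E n k ((m :: ms).map (shift δ)) =
        (encryptAll E n k (ms.map (shift δ))).bind fun cs =>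
          (E.enc n k (shift δ m)).map fun c => c :: cs :=
      PMF.bind_comm _ _ _
    rw [hswap, encryptTable]
    refine ih.bind fun cs r hr => ?_
    rw [hr.2.1, henc, PMF.map_comp]
    exact .of_support fun c hc => hr.cons hk hc

variable (E) in
/-- The operator's circuit `C` at work on the encrypted plaintexts `ms` and the platform. -/
noncomputable def platformGame (k : E.Key n) (μ : Interference)
    (ms : List (BitVec w × BitVec n)) (C : OracleCircuit (I.Op ⊕ I.Rel)) :
    PMF (List Bool × List (BitVec (E.ctLen n))) :=
  (encryptAll E n k ms).bind fun cs => C.run (platform E I n k μ) (cs.flatMap wordBits) cs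

theorem bisimilar_platformGame_tableGame (henc : EncryptsShifted E k δ Φ enc)
    (hk : k ∈ (E.gen n).support) (ms : List (BitVec w × BitVec n))
    (C : OracleCircuit (I.Op ⊕ I.Rel)) :
    Bisimilar (SameBits (Records E k δ Φ)) (platformGame E I k .observed (ms.map (shift δ)) C)
      (tableGame I enc ms C (Φ [])) := by
  refine (bisimilar_encryptAll_encryptTable henc hk ms).bind fun cs r hr => ?_
  rw [hr.cipherBits_eq]
  exact bisimilar_run (fun i q _ _ h => bisimilar_platform_tableOracle I henc hk i q h) C _ hr

end ObservedPlatform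

section Probability

open scoped ENNReal

variable {α β γ : Type}

theorem toOuterMeasure_le_one (p : PMF α) (S : Set α) : p.toOuterMeasure S ≤ 1 := by
  rw [PMF.toOuterMeasure_apply, ← p.tsum_coe]
  exact ENNReal.tsum_le_tsum fun a => Set.indicator_le_self _ _ _

theorem ofReal_prob (p : PMF α) (S : Set α) : ENNReal.ofReal (prob p S) = p.toOuterMeasure S :=
  ENNReal.ofReal_toReal (ne_top_of_le_ne_top ENNReal.one_ne_top (toOuterMeasure_le_one p S))

theorem prob_le_one (p : PMF α) (S : Set α) : prob p S ≤ 1 :=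
  ENNReal.toReal_le_of_le_ofReal zero_le_one (by simpa using toOuterMeasure_le_one p S)

theorem prob_mono (p : PMF α) {S T : Set α} (h : S ⊆ T) : prob p S ≤ prob p T :=
  ENNReal.toReal_mono (ne_top_of_le_ne_top ENNReal.one_ne_top (toOuterMeasure_le_one p T))
    (p.toOuterMeasure.mono h)

theorem prob_union_le (p : PMF α) (S T : Set α) : prob p (S ∪ T) ≤ prob p S + prob p T := by
  have hS : 0 ≤ prob p S := ENNReal.toReal_nonneg
  have hT : 0 ≤ prob p T := ENNReal.toReal_nonneg
  rw [← ENNReal.ofReal_le_ofReal_iff (add_nonneg hS hT), ENNReal.ofReal_add hS hT, ofReal_prob,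
    ofReal_prob, ofReal_prob]
  exact MeasureTheory.measure_union_le S T

theorem toOuterMeasure_bind_le_add_sum {p : PMF α} {f : α → PMF β} {g : α → PMF γ}
    {ι : Type} {J : Finset ι} {δ : ι → Type} {h : ∀ i, α → PMF (δ i)} {S : Set β} {S' : Set γ}
    {U : ∀ i, Set (δ i)}
    (H : ∀ a ∈ p.support, (f a).toOuterMeasure S ≤
      (g a).toOuterMeasure S' + ∑ i ∈ J, (h i a).toOuterMeasure (U i)) :
    (p.bind f).toOuterMeasure S ≤
      (p.bind g).toOuterMeasure S' + ∑ i ∈ J, (p.bind (h i)).toOuterMeasure (U i) := by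
  simp only [PMF.toOuterMeasure_bind_apply]
  rw [← Summable.tsum_finsetSum fun _ _ => ENNReal.summable, ← ENNReal.tsum_add]
  refine ENNReal.tsum_le_tsum fun a => ?_
  rw [← Finset.mul_sum, ← mul_add]
  by_cases ha : a ∈ p.support
  · exact mul_le_mul_right (H a ha) _
  · rw [(PMF.apply_eq_zero_iff p a).2 ha, zero_mul]
    exact zero_le

theorem toOuterMeasure_bind_le_add {p : PMF α} {f : α → PMF β} {g : α → PMF γ}
    {S : Set β} {S' : Set γ} {ε : ℝ≥0∞} (H : ∀ a, (f a).toOuterMeasure S ≤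
      (g a).toOuterMeasure S' + ε) :
    (p.bind f).toOuterMeasure S ≤ (p.bind g).toOuterMeasure S' + ε := by
  simp only [PMF.toOuterMeasure_bind_apply]
  calc ∑' a, p a * (f a).toOuterMeasure S
      ≤ ∑' a, (p a * (g a).toOuterMeasure S' + p a * ε) :=
        ENNReal.tsum_le_tsum fun a => mul_add (p a) _ _ ▸ mul_le_mul_right (H a) _
    _ = ∑' a, p a * (g a).toOuterMeasure S' + ε := by
        rw [ENNReal.tsum_add, ENNReal.tsum_mul_right, p.tsum_coe, one_mul]

theorem toOuterMeasure_bind_le {p : PMF α} {f : α → PMF β} {S : Set β} {ε : ℝ≥0∞}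
    (H : ∀ a, (f a).toOuterMeasure S ≤ ε) : (p.bind f).toOuterMeasure S ≤ ε := by
  rw [PMF.toOuterMeasure_bind_apply]
  refine (ENNReal.tsum_le_tsum fun a => mul_le_mul_right (H a) _).trans_eq ?_
  rw [ENNReal.tsum_mul_right, p.tsum_coe, one_mul]

theorem toOuterMeasure_uniformOfFintype_le [Fintype α] [Nonempty α] {S : Set α}
    [DecidablePred (· ∈ S)] {c : ℕ} (h : (Finset.univ.filter (· ∈ S)).card ≤ c) :
    (PMF.uniformOfFintype α).toOuterMeasure S ≤ c / Fintype.card α := by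
  rw [PMF.toOuterMeasure_uniformOfFintype_apply, Fintype.card_subtype]
  gcongr

theorem Bisimilar.toOuterMeasure_eq {R : α → β → Prop} {p : PMF α} {q : PMF β}
    (H : Bisimilar R p q) {S : Set α} {S' : Set β} (h : ∀ a b, R a b → (a ∈ S ↔ b ∈ S')) :
    p.toOuterMeasure S = q.toOuterMeasure S' := by
  have hmap := H.map_eq (f := (· ∈ S)) (g := (· ∈ S')) fun a b hab => propext (h a b hab)
  have hpre {δ : Type} (U : Set δ) : (· ∈ U) ⁻¹' {True} = U := by ext; simp
  simpa only [PMF.toOuterMeasure_map_apply, hpre] using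
    congrArg (fun p => p.toOuterMeasure {True}) hmap

end Probability

section UntilBad

variable {κ σ : Type} {O O' : κ → List Bool → σ → PMF (List Bool × σ)}

/-- The circuit that outputs the query of gate `i`. If gate `i` does not ask a query, this is the
whole circuit, which therefore also occurs as the case beyond the last gate. -/
def OracleCircuit.query (C : OracleCircuit κ) (i : ℕ) : OracleCircuit κ :=
  match C.gates[i]? with
  | some (.ask _ q) => ⟨C.gates.take i, q⟩
  | _ => C

theorem size_query_le (C : OracleCircuit κ) (i : ℕ) : (C.query i).size ≤ C.size := by
  unfold OracleCircuit.query
  split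
  · next k q hi =>
    obtain ⟨hlt, hget⟩ := List.getElem?_eq_some_iff.1 hi
    have hsplit := congrArg (fun gs => (gs.map Gate.cost).sum)
      (List.take_append_drop i C.gates).symm
    rw [List.drop_eq_getElem_cons hlt, hget] at hsplit
    simp only [List.map_append, List.sum_append, List.map_cons, List.sum_cons,
      Gate.cost] at hsplit
    simp only [OracleCircuit.size]
    omega
  · exact le_rfl

theorem query_cons (g : Gate κ) (gs : List (Gate κ)) (out : List ℕ) (i : ℕ) :
    (OracleCircuit.mk (g :: gs) out).query (i + 1) =
      ⟨g :: ((OracleCircuit.mk gs out).query i).gates,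
        ((OracleCircuit.mk gs out).query i).out⟩ := by
  simp only [OracleCircuit.query, List.getElem?_cons_succ]
  split <;> simp_all

theorem toOuterMeasure_run_le_add_bad {Bad : Set (List Bool × σ)}
    (h : ∀ k q s, (q, s) ∉ Bad → O k q s = O' k q s) (C : OracleCircuit κ) (input : List Bool)
    (s : σ) (S : Set (List Bool × σ)) :
    (C.run O input s).toOuterMeasure S ≤ (C.run O' input s).toOuterMeasure S +
      ∑ i ∈ Finset.range C.gates.length, ((C.query i).run O' input s).toOuterMeasure Bad := by
  obtain ⟨gs, out⟩ := C
  induction gs generalizing input s with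
  | nil => simp [OracleCircuit.run, runGates]
  | cons g gs ih =>
    rw [List.length_cons, Finset.sum_range_succ', ← add_assoc]
    simp only [query_cons]
    simp only [OracleCircuit.run] at ih ⊢
    cases g with
    | nand i j => exact (ih _ s).trans le_self_add
    | coin =>
      simp only [runGates, PMF.map_bind]
      exact (toOuterMeasure_bind_le_add_sum fun b _ => ih _ s).trans le_self_add
    | ask k q =>
      by_cases hbad : (q.map (wire input), s) ∈ Bad
      · refine (toOuterMeasure_le_one _ _).trans (le_add_left ?_)
        rw [OracleCircuit.query, List.getElem?_cons_zero]
        simp [runGates, PMF.pure_map, hbad]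
      · simp only [runGates, PMF.map_bind, h _ _ _ hbad]
        exact (toOuterMeasure_bind_le_add_sum fun r _ => ih _ r.2).trans le_self_add

end UntilBad

section Chance

variable {n : ℕ}

theorem chance_nonneg (φ : BitVec n → List Bool) : 0 ≤ chance φ := by
  unfold chance
  positivity

theorem card_bitVec (n : ℕ) : Fintype.card (BitVec n) = 2 ^ n := by
  rw [Fintype.card_congr (BitVec.equivFin (m := n)).toEquiv, Fintype.card_fin]

theorem toOuterMeasure_uniform_bitVec_le {S : Set (BitVec n)} [DecidablePred (· ∈ S)] {c : ℕ}
    (h : (Finset.univ.filter (· ∈ S)).card ≤ c) :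
    (PMF.uniformOfFintype (BitVec n)).toOuterMeasure S ≤ ENNReal.ofReal (c / 2 ^ n) := by
  refine (toOuterMeasure_uniformOfFintype_le h).trans_eq ?_
  rw [card_bitVec, ENNReal.ofReal_div_of_pos (by positivity), ENNReal.ofReal_natCast,
    ENNReal.ofReal_pow zero_le_two]
  simp

theorem toOuterMeasure_eq_attribute_le_chance (φ : BitVec n → List Bool) (x : BitVec n)
    (l : List Bool) :
    (PMF.uniformOfFintype (BitVec n)).toOuterMeasure {δ | l = φ (x + δ)} ≤
      ENNReal.ofReal (chance φ) := by
  classical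
  refine toOuterMeasure_uniform_bitVec_le ?_
  by_cases hl : ∃ δ₀, l = φ (x + δ₀)
  · obtain ⟨δ₀, rfl⟩ := hl
    refine le_trans ?_ (Finset.le_sup (Finset.mem_univ (x + δ₀)))
    refine Finset.card_le_card_of_injOn (fun δ => x + δ) (fun δ hδ => ?_)
      (add_right_injective x).injOn
    simp only [Finset.coe_filter, Finset.mem_univ, true_and, Set.mem_ofPred_eq] at hδ ⊢
    exact hδ.symm
  · have hempty : Finset.univ.filter (· ∈ {δ | l = φ (x + δ)}) = ∅ :=
      Finset.filter_eq_empty_iff.2 fun δ _ hδ => hl ⟨δ, hδ⟩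
    rw [hempty]
    exact Nat.zero_le _

theorem toOuterMeasure_map_add_eq_some_le (o : Option (BitVec n)) (y : BitVec n) :
    (PMF.uniformOfFintype (BitVec n)).toOuterMeasure {δ | o.map (· + δ) = some y} ≤
      ENNReal.ofReal (1 / 2 ^ n) := by
  classical
  refine (toOuterMeasure_uniform_bitVec_le (c := 1)
    (Finset.card_le_one.2 fun a ha b hb => ?_)).trans (by rw [Nat.cast_one])
  obtain _ | x := o
  · simp at ha
  · simp only [Option.map_some, Set.mem_ofPred_eq, Option.some.injEq, Finset.mem_filter,
      Finset.mem_univ, true_and] at ha hb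
    exact add_left_cancel (ha.trans hb.symm)

end Chance

namespace Program

variable {I : InstructionSet w} {n : ℕ} (P : Program I n)

/-- The scheme whose offsets are those of `D` moved by `δ`. -/
def shiftScheme (D : P.Scheme) (δ : BitVec n) : P.Scheme := fun a l => D a l + δ

variable {P}

theorem Consistent.shiftScheme {D : P.Scheme} (hD : P.Consistent D) (δ : BitVec n) :
    P.Consistent (P.shiftScheme D δ) := by
  intro a
  have hrow {b c} (h : D b = D c) : P.shiftScheme D δ b = P.shiftScheme D δ c :=
    funext fun l => congrArg (· + δ) (congrFun h l)
  have hentry {b c l l'} (h : D b l = D c l') :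
      P.shiftScheme D δ b l = P.shiftScheme D δ c l' := congrArg (· + δ) h
  have ha := hD a
  unfold Respects at ha ⊢
  split at ha
  · exact fun l hl => hentry (ha l hl)
  · exact ⟨hentry ha.1, fun l hl => hentry (ha.2 l hl)⟩
  · exact ⟨hrow ha.1, hrow ha.2⟩
  · exact hrow ha

/-- Adding `δ` to all offsets permutes the consistent schemes. -/
def shiftSchemeEquiv (δ : BitVec n) :
    {D : P.Scheme // P.Consistent D} ≃ {D : P.Scheme // P.Consistent D} where
  toFun D := ⟨P.shiftScheme D.1 δ, D.2.shiftScheme δ⟩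
  invFun D := ⟨P.shiftScheme D.1 (-δ), D.2.shiftScheme (-δ)⟩
  left_inv D := Subtype.ext (funext fun a => funext fun l => add_neg_cancel_right (D.1 a l) δ)
  right_inv D := Subtype.ext (funext fun a => funext fun l => neg_add_cancel_right (D.1 a l) δ)

theorem randomScheme_bind_shiftScheme {β : Type}
    (F : {D : P.Scheme // P.Consistent D} → PMF β) :
    P.randomScheme.bind F = (PMF.uniformOfFintype (BitVec n)).bind fun δ =>
      P.randomScheme.bind fun D => F ⟨P.shiftScheme D.1 δ, D.2.shiftScheme δ⟩ := by
  classical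
  have hshift (δ) : (P.randomScheme.bind fun D => F ⟨P.shiftScheme D.1 δ, D.2.shiftScheme δ⟩) =
      P.randomScheme.bind F := by
    conv_rhs => rw [randomScheme, ← uniformOfFintype_map_equiv (shiftSchemeEquiv δ), PMF.bind_map]
    rfl
  simp only [hshift, PMF.bind_const]

theorem itemPlains_shiftScheme (D : P.Scheme) (d : Fin P.locs → BitVec n) (δ : BitVec n)
    (x : Fin P.locs ⊕ Fin P.len) :
    P.itemPlains (P.shiftScheme D δ) d x = (P.itemPlains D d x).map (shift δ) := by
  rcases x with l | a
  · simp [itemPlains, compileInput, shiftScheme, shift, add_assoc]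
  · simp only [itemPlains, compile]
    split <;> simp [ObjInstr.constants, shiftScheme, shift, add_assoc]

theorem compiledRun_shiftScheme {D : P.Scheme} (hD : P.Consistent D) (d : Fin P.locs → BitVec n)
    (δ : BitVec n) (t : ℕ) (r : Fin P.locs) :
    (P.compiledRun (P.shiftScheme D δ) d t).store r = (P.compiledRun D d t).store r + δ := by
  rw [compiledRun_eq P hD, compiledRun_eq P (hD.shiftScheme δ)]
  exact (add_assoc _ _ _).symm

theorem length_itemPlains_le (D : P.Scheme) (d : Fin P.locs → BitVec n)
    (x : Fin P.locs ⊕ Fin P.len) : (P.itemPlains D d x).length ≤ 3 := by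
  rcases x with l | a
  · simp [itemPlains]
  · simp only [itemPlains, compile]
    split <;> simp [ObjInstr.constants]

end Program

namespace Operator

variable {I : InstructionSet w} (A : Operator I) (E : Encryption w)

/-- The plaintexts beneath the ciphertexts that the operator is shown at the start. -/
def items (n : ℕ) (D : (A.prog n).Scheme) : List (BitVec w × BitVec n) :=
  (A.view n).flatMap ((A.prog n).itemPlains D (A.input n))

theorem length_items_le (n : ℕ) (D : (A.prog n).Scheme) :
    (A.items n D).length ≤ 3 * (A.view n).length := by
  rw [items, List.length_flatMap, mul_comm]
  refine (List.sum_le_card_nsmul _ 3 fun c hc => ?_).trans_eq (by simp)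
  obtain ⟨x, -, rfl⟩ := List.mem_map.1 hc
  exact Program.length_itemPlains_le _ _ x

theorem items_shiftScheme (n : ℕ) (D : (A.prog n).Scheme) (δ : BitVec n) :
    A.items n ((A.prog n).shiftScheme D δ) = (A.items n D).map (shift δ) := by
  rw [items, items, List.map_flatMap]
  exact congrArg (fun f => List.flatMap f (A.view n))
    (funext fun x => Program.itemPlains_shiftScheme D _ δ x)

theorem game_eq (μ : Interference) (n : ℕ) :
    A.game E μ n = (A.prog n).randomScheme.bind fun D => (E.gen n).bind fun k =>
      (platformGame E I k μ (A.items n D.1) (A.circuit n)).map fun r => ⟨k, D.1, r.1, r.2⟩ := by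
  simp only [platformGame, PMF.map_bind]
  exact PMF.bind_comm _ _ _

end Operator

namespace PolyBounded

variable {f g : ℕ → ℕ}

theorem mono (hg : PolyBounded g) (h : ∀ n, f n ≤ g n) : PolyBounded f :=
  hg.imp fun _ hp n => (h n).trans (hp n)

theorem const (c : ℕ) : PolyBounded fun _ => c := ⟨Polynomial.C c, fun n => by simp⟩

theorem id : PolyBounded fun n => n := ⟨Polynomial.X, fun n => by simp⟩

theorem add (hf : PolyBounded f) (hg : PolyBounded g) : PolyBounded fun n => f n + g n := by
  obtain ⟨p, hp⟩ := hf
  obtain ⟨q, hq⟩ := hg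
  exact ⟨p + q, fun n => Polynomial.eval_add (p := p) ▸ add_le_add (hp n) (hq n)⟩

theorem mul (hf : PolyBounded f) (hg : PolyBounded g) : PolyBounded fun n => f n * g n := by
  obtain ⟨p, hp⟩ := hf
  obtain ⟨q, hq⟩ := hg
  exact ⟨p * q, fun n => Polynomial.eval_mul (p := p) ▸ Nat.mul_le_mul (hp n) (hq n)⟩

theorem sum {ι : Type*} (s : Finset ι) {f : ι → ℕ → ℕ} (h : ∀ i ∈ s, PolyBounded (f i)) :
    PolyBounded fun n => ∑ i ∈ s, f i n := by
  choose! p hp using h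
  exact ⟨∑ i ∈ s, p i, fun n => by
    rw [Polynomial.eval_finsetSum]; exact Finset.sum_le_sum fun i hi => hp i hi n⟩

theorem addCost : PolyBounded fun n => addCost n :=
  id.mul ((id.mul (const 88)).add (const 46))

theorem lookupCost {ℓ t : ℕ → ℕ} (hℓ : PolyBounded ℓ) (ht : PolyBounded t) :
    PolyBounded fun n => lookupCost w (ℓ n) n (t n) :=
  (ht.mul ((((hℓ.mul (const 44)).add (const (w * 44))).add (id.mul (const 14))).add
    (const 44))).add (const 2)

theorem instrCost {ℓ t s S : ℕ → ℕ} (hℓ : PolyBounded ℓ) (ht : PolyBounded t)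
    (hs : PolyBounded s) (hS : PolyBounded S) :
    PolyBounded fun n => instrCost w (ℓ n) n (t n) (s n) (S n) :=
  ((((((const 10).mul ((hs.add (hℓ.mul (const 2))).add (lookupCost hℓ ht))).add
    ((const 4).mul ((((const 2).mul addCost).add (id.mul (const 5))).add (const 2)))).add
    ((const 2).mul addCost)).add ((const 10).mul hS)).add (id.mul (const 150))).add (const 400)

theorem simulatorCost {ℓ m c S : ℕ → ℕ} (hℓ : PolyBounded ℓ) (hm : PolyBounded m)
    (hc : PolyBounded c) (hS : PolyBounded S) :
    PolyBounded fun n => simulatorCost w (ℓ n) n (m n) (c n) (S n) :=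
  have hplain (a : ℕ) : PolyBounded fun n => a * (w + n) := (const a).mul ((const w).add id)
  ((hm.mul ((addCost.add (hplain 2)).add (const 13))).add
    (hc.mul (((((const 3).mul (instrCost hℓ (hm.add hc) (hc.mul (const 2)) hS)).add addCost).add
      (hplain 4)).add (const 10)))).add (hc.mul (const 2))

theorem mul_negligible (hf : PolyBounded f) {ε : ℕ → ℝ} (hε : Negligible ε) :
    Negligible fun n => (f n : ℝ) * ε n := by
  obtain ⟨p, hp⟩ := hf
  refine (hε.polynomial_mul (p.map (Nat.castRingHom ℝ))).trans_abs_le fun n => ?_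
  rw [abs_mul, abs_mul, Polynomial.eval_natCast_map, Nat.abs_cast]
  exact mul_le_mul_of_nonneg_right ((Nat.cast_le.2 (hp n)).trans (le_abs_self _)) (abs_nonneg _)

end PolyBounded

theorem simulatorCost_mono {ℓ n m m' c c' S : ℕ} (hm : m ≤ m') (hc : c ≤ c') :
    simulatorCost w ℓ n m c S ≤ simulatorCost w ℓ n m' c' S :=
  Nat.add_le_add (Nat.add_le_add (Nat.mul_le_mul_right _ hm)
    (Nat.mul_le_mul hc (gateCost_mono (Nat.add_le_add hm hc) hc))) (Nat.mul_le_mul_right _ hc)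

theorem exists_unitsBounded (I : InstructionSet w) :
    ∃ S, PolyBounded S ∧ ∀ n, UnitsBounded I n (S n) := by
  have hOp : Finite I.Op := Finite.of_injective (fun θ => I.tag (.opConst θ 0)) fun a b h => by
    simpa using I.tag_injective h
  have hRel : Finite I.Rel := Finite.of_injective (fun R => I.tag (.relConst R 0)) fun a b h => by
    simpa using I.tag_injective h
  have := Fintype.ofFinite I.Op
  have := Fintype.ofFinite I.Rel
  choose C hC hCeval using I.eval_poly
  choose C' hC' hC'eval using I.test_poly
  refine ⟨fun n => (∑ θ, (C θ n).size) + ∑ R, (C' R n).size,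
    (PolyBounded.sum _ fun θ _ => hC θ).add (PolyBounded.sum _ fun R _ => hC' R), fun n =>
    ⟨fun θ => ⟨C θ n, ?_, hCeval θ n⟩, fun R => ⟨C' R n, ?_, hC'eval R n⟩⟩⟩
  · exact (Finset.single_le_sum (f := fun θ => (C θ n).size) (fun _ _ => Nat.zero_le _)
      (Finset.mem_univ θ)).trans (Nat.le_add_right _ _)
  · exact (Finset.single_le_sum (f := fun R => (C' R n).size) (fun _ _ => Nat.zero_le _)
      (Finset.mem_univ R)).trans (Nat.le_add_left _ _)

section LeftOrRight

variable (E : Encryption w) {n : ℕ}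

/-- Encrypts the plaintext `m` or, on the right-hand side `i.2 = true`, its shift by `δ`. -/
noncomputable def encryptSide (δ : BitVec n) (i : E.Key n × Bool) (m : BitVec w × BitVec n)
    (_ : Unit) : PMF (BitVec (E.ctLen n) × Unit) :=
  (E.enc n i.1 (if i.2 then shift δ m else m)).map fun c => (c, ())

theorem readPlain_shiftQuery_left (δ : BitVec n) (m : BitVec w × BitVec n) :
    Encryption.readPlain w n 0 (shiftQuery δ m) = m :=
  readPlain_append (s := []) rfl m _

theorem readPlain_shiftQuery_right (δ : BitVec n) (m : BitVec w × BitVec n) :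
    Encryption.readPlain w n (w + n) (shiftQuery δ m) = shift δ m := by
  simpa only [shiftQuery, List.append_nil] using
    readPlain_append (length_plainBits m) (shift δ m) []

theorem issues_leftRight (δ : BitVec n) :
    Issues (fun i : E.Key n × Bool => E.leftRight n i.1 i.2) δ (encryptSide E δ) := fun i m s => by
  simp only [Encryption.leftRight, readPlain_shiftQuery_left, readPlain_shiftQuery_right,
    encryptSide, PMF.map_comp, Function.comp_def]

theorem encryptsShifted_encryptSide (k : E.Key n) (δ : BitVec n) :
    EncryptsShifted E k δ (fun _ => ()) (encryptSide E δ (k, true)) := fun _ _ => rfl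

end LeftOrRight

theorem exists_negligible_of_size_le {F : ℕ → OracleCircuit Unit → ℝ} (h₀ : ∀ n C, 0 ≤ F n C)
    (h₁ : ∀ n C, F n C ≤ 1)
    (hF : ∀ C : ℕ → OracleCircuit Unit, PolyBounded (fun n => (C n).size) →
      Negligible fun n => F n (C n)) {s : ℕ → ℕ} (hs : PolyBounded s) :
    ∃ ε, Negligible ε ∧ ∀ n (C : OracleCircuit Unit), C.size ≤ s n → F n C ≤ ε n := by
  have hworst (n : ℕ) : ∃ C₀ : OracleCircuit Unit, C₀.size ≤ s n ∧
      ∀ C : OracleCircuit Unit, C.size ≤ s n → F n C ≤ 2 * F n C₀ := by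
    by_contra! hlarger
    let values := F n '' {C | C.size ≤ s n}
    have hbdd : BddAbove values := ⟨1, Set.forall_mem_image.2 fun C _ => h₁ n C⟩
    obtain ⟨C₁, hC₁, hpos⟩ := hlarger ⟨[], []⟩ (Nat.zero_le _)
    have hsup := le_csSup hbdd (Set.mem_image_of_mem (F n) hC₁)
    have hempty := h₀ n ⟨[], []⟩
    obtain ⟨-, ⟨C₂, hC₂, rfl⟩, hhalf⟩ := exists_lt_of_lt_csSup
      ⟨_, Set.mem_image_of_mem (F n) hC₁⟩ (half_lt_self (show 0 < sSup values by linarith))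
    obtain ⟨C₃, hC₃, hdouble⟩ := hlarger C₂ hC₂
    linarith [le_csSup hbdd (Set.mem_image_of_mem (F n) hC₃)]
  choose C₀ hsize hle using hworst
  exact ⟨fun n => 2 * F n (C₀ n), (hF C₀ (hs.mono hsize)).const_mul 2, hle⟩

section Observed

variable {I : InstructionSet w} (A : Operator I) (E : Encryption w)

/-- A test of the operator's output and table decides, in the game whose scheme is `D` moved by `δ`,
whether the outcome is in `W`. It takes at most `d` gates, and a fixed output and table pass it for
at most the proportion `p` of the offsets `δ`. -/
structure DecidesByOffset {n : ℕ} (W : Set (A.Outcome E n))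
    (test : (A.prog n).Scheme → BitVec n → List Bool → Table w (E.ctLen n) n → Bool)
    (d : ℕ) (p : ℝ) : Prop where
  mem_iff {k : E.Key n} {δ : BitVec n} {D : (A.prog n).Scheme} {issued : List (BitVec (E.ctLen n))}
    {r : Table w (E.ctLen n) n × Unit} (hD : (A.prog n).Consistent D)
    (hr : Records E k δ (fun _ => ()) issued r) (out : List Bool) :
    ⟨k, (A.prog n).shiftScheme D δ, out, issued⟩ ∈ W ↔ test D δ out r.1 = true
  computes (D : (A.prog n).Scheme) (δ : BitVec n) {t : ℕ}
    (ht : t ≤ 3 * (A.view n).length + (A.circuit n).size) :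
    Computes ((A.circuit n).out.length + t * (E.ctLen n + (w + n))) 1 d
      (SimState.bits (v := (A.circuit n).out.length) (t := t))
      fun x => [test D δ x.1.toList x.2.toList]
  proportion_le (D : (A.prog n).Scheme) (out : List Bool) (T : Table w (E.ctLen n) n) :
    (PMF.uniformOfFintype (BitVec n)).toOuterMeasure {δ | test D δ out T = true} ≤ ENNReal.ofReal p

variable {A E} {n d S : ℕ} {W : Set (A.Outcome E n)} {p : ℝ}
  {test : (A.prog n).Scheme → BitVec n → List Bool → Table w (E.ctLen n) n → Bool}

variable (A E) in
/-- The game on a table, where the plaintexts are encrypted without (`side = false`) or with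
(`side = true`) the move by `δ`. -/
noncomputable def sideGame (n : ℕ) (side : Bool) (D : (A.prog n).Scheme) (δ : BitVec n) :
    PMF (List Bool × Table w (E.ctLen n) n × Unit) :=
  (E.gen n).bind fun k => tableGame I (encryptSide E δ (k, side)) (A.items n D) (A.circuit n) ()

theorem sideGame_false (D : (A.prog n).Scheme) (δ : BitVec n) :
    sideGame A E n false D δ = sideGame A E n false D 0 := rfl

namespace DecidesByOffset

theorem toOuterMeasure_platformGame (H : DecidesByOffset A E W test d p)
    {D : (A.prog n).Scheme} (hD : (A.prog n).Consistent D) (δ : BitVec n) :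
    ((E.gen n).bind fun k => (platformGame E I k .observed
      (A.items n ((A.prog n).shiftScheme D δ)) (A.circuit n)).map fun r =>
        (⟨k, (A.prog n).shiftScheme D δ, r.1, r.2⟩ : A.Outcome E n)).toOuterMeasure W =
      (sideGame A E n true D δ).toOuterMeasure {r | test D δ r.1 r.2.1 = true} := by
  refine Bisimilar.toOuterMeasure_eq
    (R := fun o (r : List Bool × Table w (E.ctLen n) n × Unit) =>
      o ∈ W ↔ test D δ r.1 r.2.1 = true) ((Bisimilar.refl_support _).bind ?_)
    fun _ _ hwin => hwin
  rintro k _ ⟨rfl, hk⟩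
  rw [A.items_shiftScheme, ← PMF.map_id (tableGame _ _ _ _ _)]
  refine (bisimilar_platformGame_tableGame I (encryptsShifted_encryptSide E k δ) hk _ _).map ?_
  rintro ⟨out, issued⟩ r ⟨hout, hr⟩
  subst hout
  exact H.mem_iff hD hr _

theorem exists_distinguisher (H : DecidesByOffset A E W test d p) (hS : UnitsBounded I n S)
    (D : (A.prog n).Scheme) (δ : BitVec n) :
    ∃ C : OracleCircuit Unit, C.size ≤ simulatorCost w (E.ctLen n) n (3 * (A.view n).length)
        (A.circuit n).size S + d + 1 ∧
      ∀ side, ENNReal.ofReal (E.acceptProb n C side) =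
        (sideGame A E n side D δ).toOuterMeasure {r | test D δ r.1 r.2.1 = true} := by
  have hitems := A.length_items_le n D
  obtain ⟨C, hC, hrun⟩ := exists_simulator (issues_leftRight E δ) hS (A.circuit n) (A.items n D)
    (h := fun out T => [test D δ out T]) fun t ht => H.computes D δ (by omega)
  refine ⟨C, hC.trans ?_, fun side => ?_⟩
  · gcongr
    exact simulatorCost_mono hitems le_rfl
  · simp only [Encryption.acceptProb, ofReal_prob, fun k => hrun (k, side), sideGame,
      ← PMF.map_bind, PMF.toOuterMeasure_map_apply]
    congr 1
    ext r
    simp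

theorem uniform_sideGame_false_le (H : DecidesByOffset A E W test d p)
    (D : (A.prog n).Scheme) :
    ((PMF.uniformOfFintype (BitVec n)).bind fun δ => (sideGame A E n false D δ).map fun r =>
      test D δ r.1 r.2.1).toOuterMeasure {true} ≤ ENNReal.ofReal p := by
  simp only [fun δ => sideGame_false (A := A) (E := E) D δ]
  refine le_of_eq_of_le (congrArg (fun q => PMF.toOuterMeasure q {true}) (PMF.bind_comm _ _ _)) ?_
  refine toOuterMeasure_bind_le fun r => ?_
  exact (PMF.toOuterMeasure_map_apply (fun δ => test D δ r.1 r.2.1) _ _).trans_le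
    (H.proportion_le D r.1 r.2.1)

theorem prob_observed_le (H : DecidesByOffset A E W test d p) (hp : 0 ≤ p)
    (hS : UnitsBounded I n S) {ε : ℝ}
    (hε : ∀ C : OracleCircuit Unit, C.size ≤ simulatorCost w (E.ctLen n) n
        (3 * (A.view n).length) (A.circuit n).size S + d + 1 →
      |E.acceptProb n C true - E.acceptProb n C false| ≤ ε) :
    prob (A.game E .observed n) W ≤ p + ε := by
  have hε₀ : 0 ≤ ε := (abs_nonneg _).trans (hε ⟨[], []⟩ (Nat.zero_le _))
  have hsides (D : (A.prog n).Scheme) (δ : BitVec n) :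
      (sideGame A E n true D δ).toOuterMeasure {r | test D δ r.1 r.2.1 = true} ≤
        (sideGame A E n false D δ).toOuterMeasure {r | test D δ r.1 r.2.1 = true} +
          ENNReal.ofReal ε := by
    obtain ⟨C, hC, haccept⟩ := H.exists_distinguisher hS D δ
    have hdiff := (le_abs_self _).trans (hε C hC)
    have hpos : 0 ≤ E.acceptProb n C false := ENNReal.toReal_nonneg
    rw [← haccept, ← haccept, ← ENNReal.ofReal_add hpos hε₀]
    exact ENNReal.ofReal_le_ofReal (by linarith)
  rw [← ENNReal.ofReal_le_ofReal_iff (add_nonneg hp hε₀), ENNReal.ofReal_add hp hε₀, ofReal_prob,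
    A.game_eq, Program.randomScheme_bind_shiftScheme, PMF.bind_comm]
  refine toOuterMeasure_bind_le fun D => ?_
  refine (toOuterMeasure_bind_le_add fun δ => ?_).trans
    (add_le_add_left (H.uniform_sideGame_false_le D.1) _)
  rw [H.toOuterMeasure_platformGame D.2, PMF.toOuterMeasure_map_apply]
  exact hsides D.1 δ

end DecidesByOffset

theorem exists_negligible_observed (hE : E.INDCPA) (hA : A.PolyTime)
    {W : ∀ n, Set (A.Outcome E n)} {p : ℕ → ℝ} (hp : ∀ n, 0 ≤ p n) {d : ℕ → ℕ}
    (hd : PolyBounded d)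
    {test : ∀ n, (A.prog n).Scheme → BitVec n → List Bool → Table w (E.ctLen n) n → Bool}
    (H : ∀ n, DecidesByOffset A E (W n) (test n) (d n) (p n)) :
    ∃ ε : ℕ → ℝ, Negligible ε ∧ ∀ n, prob (A.game E .observed n) (W n) ≤ p n + ε n := by
  obtain ⟨S, hS, hunits⟩ := exists_unitsBounded I
  have hle (n : ℕ) (C : OracleCircuit Unit) :
      |E.acceptProb n C true - E.acceptProb n C false| ≤ 1 :=
    abs_sub_le_iff.2 ⟨(sub_le_self _ ENNReal.toReal_nonneg).trans (prob_le_one _ _),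
      (sub_le_self _ ENNReal.toReal_nonneg).trans (prob_le_one _ _)⟩
  obtain ⟨ε, hε, hsize⟩ := exists_negligible_of_size_le (fun _ _ => abs_nonneg _) hle hE
    (((PolyBounded.simulatorCost (w := w) E.ctLen_poly ((PolyBounded.const 3).mul hA.1) hA.2 hS).add
      hd).add (.const 1))
  exact ⟨ε, hε, fun n => (H n).prob_observed_le (hp n) (hunits n) (hsize n)⟩

end Observed

section Forgery

variable (E : Encryption w) (I : InstructionSet w) {n S : ℕ}

/-- Encrypts a plaintext and records the ciphertext, as the encryption oracle does. -/
noncomputable def encryptRecording (k : E.Key n) (m : BitVec w × BitVec n)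
    (issued : List (BitVec (E.ctLen n))) : PMF (BitVec (E.ctLen n) × List (BitVec (E.ctLen n))) :=
  (E.enc n k m).map fun c => (c, c :: issued)

theorem issues_encOracle : Issues (E.encOracle n) 0 (encryptRecording E) := fun k m s => by
  simp only [Encryption.encOracle, readPlain_shiftQuery_left, encryptRecording, PMF.map_comp,
    Function.comp_def]

theorem shift_zero : shift (w := w) (0 : BitVec n) = id :=
  funext fun m => by simp [shift]

theorem encryptsShifted_encryptRecording (k : E.Key n) :
    EncryptsShifted E k 0 id (encryptRecording E k) := fun m issued => by
  rw [shift_zero]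
  rfl

/-- The event that the bits after an interaction have, as the `j`-th word, a forgery: a valid
ciphertext that was not issued. -/
def forgery (n j : ℕ) : Set (E.Key n × List Bool × List (BitVec (E.ctLen n))) :=
  {r | readWord (E.ctLen n) (j * E.ctLen n) r.2.1 ∉ r.2.2 ∧
    (E.dec n r.1 (readWord (E.ctLen n) (j * E.ctLen n) r.2.1)).isSome}

variable {E} {k : E.Key n} {q : List Bool} {issued : List (BitVec (E.ctLen n))}

theorem contentOf_arbitrary_of_notMem_forgery {j : ℕ} (h : (k, q, issued) ∉ forgery E n j)
    (κ : WordKind I.Op I.Rel) :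
    contentOf E I n k .arbitrary issued κ (readWord (E.ctLen n) (j * E.ctLen n) q) =
      contentOf E I n k .observed issued κ (readWord (E.ctLen n) (j * E.ctLen n) q) := by
  unfold contentOf plainOf
  split_ifs with hissued
  · rfl
  · rw [Option.not_isSome_iff_eq_none.1 fun hvalid => h ⟨hissued, hvalid⟩]

theorem platform_arbitrary_of_notMem_forgery (h : ∀ j < 5, (k, q, issued) ∉ forgery E n j)
    (i : I.Op ⊕ I.Rel) :
    platform E I n k .arbitrary i q issued = platform E I n k .observed i q issued := by
  have hcontent (j : ℕ) (hj : j < 5) := contentOf_arbitrary_of_notMem_forgery I (h j hj)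
  cases i with
  | inl θ => simp only [platform, hcontent 0 (by decide), hcontent 1 (by decide),
      hcontent 2 (by decide), hcontent 3 (by decide), hcontent 4 (by decide)]
  | inr R => simp only [platform, hcontent 0 (by decide), hcontent 1 (by decide),
      hcontent 2 (by decide), hcontent 3 (by decide)]

variable (E) in
/-- The operator's circuit `C` at work on the encrypted plaintexts `ms`, under a random key. -/
noncomputable def keyedGame (n : ℕ) (μ : Interference) (ms : List (BitVec w × BitVec n))
    (C : OracleCircuit (I.Op ⊕ I.Rel)) :
    PMF (E.Key n × List Bool × List (BitVec (E.ctLen n))) :=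
  (E.gen n).bind fun k => (platformGame E I k μ ms C).map (k, ·)

theorem keyedGame_arbitrary_le (ms : List (BitVec w × BitVec n))
    (C : OracleCircuit (I.Op ⊕ I.Rel))
    (W : Set (E.Key n × List Bool × List (BitVec (E.ctLen n)))) :
    (keyedGame E I n .arbitrary ms C).toOuterMeasure W ≤
      (keyedGame E I n .observed ms C).toOuterMeasure W +
        ∑ x ∈ Finset.range C.gates.length ×ˢ Finset.range 5,
          (keyedGame E I n .observed ms (C.query x.1)).toOuterMeasure (forgery E n x.2) := by
  refine toOuterMeasure_bind_le_add_sum fun k _ => ?_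
  simp only [PMF.toOuterMeasure_map_apply]
  refine toOuterMeasure_bind_le_add_sum fun cs _ => ?_
  let Bad : Set (List Bool × List (BitVec (E.ctLen n))) :=
    ⋃ j ∈ Finset.range 5, (k, ·) ⁻¹' forgery E n j
  refine (toOuterMeasure_run_le_add_bad (Bad := Bad) (fun i q issued hgood =>
    platform_arbitrary_of_notMem_forgery I (fun j hj hforged => hgood ?_) i) C _ cs _).trans ?_
  · exact Set.mem_biUnion (Finset.mem_coe.2 (Finset.mem_range.2 hj)) hforged
  · rw [Finset.sum_product]
    gcongr
    exact MeasureTheory.measure_biUnion_finset_le _ _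

theorem exists_forger (hS : UnitsBounded I n S) (ms : List (BitVec w × BitVec n))
    (C : OracleCircuit (I.Op ⊕ I.Rel)) (j : ℕ) :
    ∃ F : OracleCircuit Unit, F.size ≤ simulatorCost w (E.ctLen n) n ms.length C.size S +
        E.ctLen n * 3 ∧
      ENNReal.ofReal (E.forgeProb n F) =
        (keyedGame E I n .observed ms C).toOuterMeasure (forgery E n j) := by
  obtain ⟨F, hF, hrun⟩ := exists_simulator (issues_encOracle E) hS C ms
    (h := fun out _ => wordBits (readWord (E.ctLen n) (j * E.ctLen n) out))
    fun t _ => SimState.computes_wires.trans (Computes.readWord _ _ _)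
  refine ⟨F, hF.trans (by omega), ?_⟩
  rw [Encryption.forgeProb, ofReal_prob]
  have hword (x : BitVec (E.ctLen n)) : readWord (E.ctLen n) 0 (wordBits x) = x := by
    simpa using readWord_append (s := []) rfl x []
  refine (Bisimilar.toOuterMeasure_eq (R := fun r r' => r.1 = r'.1 ∧
      readWord (E.ctLen n) (j * E.ctLen n) r.2.1 = r'.2.1 ∧ r.2.2 = r'.2.2)
    ((Bisimilar.refl_support _).bind ?_) ?_).symm
  · rintro k _ ⟨rfl, hk⟩
    have hgame := bisimilar_platformGame_tableGame I (encryptsShifted_encryptRecording E k) hk ms C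
    rw [shift_zero, List.map_id] at hgame
    rw [hrun, PMF.map_comp]
    refine hgame.map fun r r' hr => ⟨rfl, ?_, hr.2.2.1.symm⟩
    simp only [Function.comp_apply, hword, hr.1]
  · rintro ⟨k, out, issued⟩ ⟨_, c, _⟩ ⟨rfl, rfl, rfl⟩
    rfl

end Forgery

namespace Operator

variable {I : InstructionSet w} (A : Operator I) (E : Encryption w) {n S : ℕ}

theorem game_eq_keyedGame (μ : Interference) :
    A.game E μ n = (A.prog n).randomScheme.bind fun D =>
      (keyedGame E I n μ (A.items n D.1) (A.circuit n)).map fun r => ⟨r.1, D.1, r.2.1, r.2.2⟩ := by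
  simp only [game_eq, keyedGame, PMF.map_bind, PMF.map_comp]
  rfl

/-- The size of a forger that plays the game and outputs one word of a query or of the output. -/
def forgerCost (n S : ℕ) : ℕ :=
  simulatorCost w (E.ctLen n) n (3 * (A.view n).length) (A.circuit n).size S + E.ctLen n * 3

/-- The outcomes with a forgery as the first word of the output. -/
def forges (n : ℕ) : Set (A.Outcome E n) :=
  {o | (o.key, o.output, o.issued) ∈ forgery E n 0}

variable {A E} {ν : ℝ}

theorem toOuterMeasure_keyedGame_forgery_le (hS : UnitsBounded I n S)
    (hν : ∀ F : OracleCircuit Unit, F.size ≤ A.forgerCost E n S → E.forgeProb n F ≤ ν)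
    (D : (A.prog n).Scheme) {C : OracleCircuit (I.Op ⊕ I.Rel)} (hC : C.size ≤ (A.circuit n).size)
    (j : ℕ) :
    (keyedGame E I n .observed (A.items n D) C).toOuterMeasure (forgery E n j) ≤
      ENNReal.ofReal ν := by
  obtain ⟨F, hF, hforge⟩ := exists_forger I hS (A.items n D) C j
  rw [← hforge]
  refine ENNReal.ofReal_le_ofReal (hν F (hF.trans ?_))
  exact Nat.add_le_add_right (simulatorCost_mono (A.length_items_le n D) hC) _

theorem prob_forges_observed_le (hS : UnitsBounded I n S)
    (hν : ∀ F : OracleCircuit Unit, F.size ≤ A.forgerCost E n S → E.forgeProb n F ≤ ν)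
    (hν₀ : 0 ≤ ν) : prob (A.game E .observed n) (A.forges E n) ≤ ν := by
  rw [← ENNReal.ofReal_le_ofReal_iff hν₀, ofReal_prob, game_eq_keyedGame]
  refine toOuterMeasure_bind_le fun D => ?_
  rw [PMF.toOuterMeasure_map_apply]
  exact toOuterMeasure_keyedGame_forgery_le hS hν D.1 le_rfl 0

theorem prob_arbitrary_le (hS : UnitsBounded I n S)
    (hν : ∀ F : OracleCircuit Unit, F.size ≤ A.forgerCost E n S → E.forgeProb n F ≤ ν)
    (hν₀ : 0 ≤ ν) (W : Set (A.Outcome E n)) :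
    prob (A.game E .arbitrary n) W ≤
      prob (A.game E .observed n) W + ((A.circuit n).size * 5 : ℕ) * ν := by
  have hobs : 0 ≤ prob (A.game E .observed n) W := ENNReal.toReal_nonneg
  have hloss : 0 ≤ ((A.circuit n).size * 5 : ℕ) * ν := by positivity
  rw [← ENNReal.ofReal_le_ofReal_iff (by positivity), ENNReal.ofReal_add hobs hloss, ofReal_prob,
    ofReal_prob, game_eq_keyedGame, game_eq_keyedGame]
  refine toOuterMeasure_bind_le_add fun D => ?_
  simp only [PMF.toOuterMeasure_map_apply]
  refine (keyedGame_arbitrary_le I _ _ _).trans (add_le_add_right ?_ _)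
  refine (Finset.sum_le_card_nsmul _ _ (ENNReal.ofReal ν) fun x _ =>
    toOuterMeasure_keyedGame_forgery_le hS hν D.1 (size_query_le _ _) _).trans ?_
  rw [Finset.card_product, Finset.card_range, Finset.card_range, nsmul_eq_mul,
    ENNReal.ofReal_mul (Nat.cast_nonneg _), ENNReal.ofReal_natCast]
  gcongr
  exact length_gates_le_size _

theorem exists_negligible_arbitrary (hE : E.INTCTXT) (hA : A.PolyTime) :
    ∃ ε : ℕ → ℝ, Negligible ε ∧ ∀ n,
      prob (A.game E .observed n) (A.forges E n) ≤ ε n ∧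
      ∀ W, prob (A.game E .arbitrary n) W ≤ prob (A.game E .observed n) W + ε n := by
  obtain ⟨S, hS, hunits⟩ := exists_unitsBounded I
  have hcost : PolyBounded fun n => A.forgerCost E n (S n) :=
    (PolyBounded.simulatorCost E.ctLen_poly ((PolyBounded.const 3).mul hA.1) hA.2 hS).add
      (E.ctLen_poly.mul (.const 3))
  have hpos (n : ℕ) (F : OracleCircuit Unit) : 0 ≤ E.forgeProb n F := ENNReal.toReal_nonneg
  obtain ⟨ν, hν, hforge⟩ := exists_negligible_of_size_le hpos (fun _ _ => prob_le_one _ _) hE hcost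
  have hν₀ (n : ℕ) : 0 ≤ ν n := (hpos n _).trans (hforge n ⟨[], []⟩ (Nat.zero_le _))
  refine ⟨fun n => ν n + ((A.circuit n).size * 5 : ℕ) * ν n,
    hν.add ((hA.2.mul (.const 5)).mul_negligible hν), fun n => ⟨?_, fun W => ?_⟩⟩
  · refine (prob_forges_observed_le (hunits n) (hforge n) (hν₀ n)).trans ?_
    exact le_add_of_nonneg_right (mul_nonneg (Nat.cast_nonneg _) (hν₀ n))
  · refine (prob_arbitrary_le (hunits n) (hforge n) (hν₀ n) W).trans ?_
    linarith [hν₀ n]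

end Operator

namespace Operator

variable {I : InstructionSet w} (A : Operator I) (E : Encryption w) {n : ℕ}

theorem decidesByOffset_discovers (t : ℕ) (r : Fin (A.prog n).locs) (φ : BitVec n → List Bool) :
    DecidesByOffset A E (A.discovers E t r φ)
      (fun D δ out _ => decide
        (out = φ (((A.prog n).compiledRun D (A.input n) t).store r + δ)))
      ((A.circuit n).size * 44 + 4) (chance φ) where
  mem_iff hD _ out := by
    rw [discovers, Set.mem_ofPred_eq, Program.compiledRun_shiftScheme hD, decide_eq_true_iff]
  computes D δ s _ := by
    have hsize : (A.circuit n).out.length ≤ (A.circuit n).size := Nat.le_add_left _ _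
    generalize φ _ = answer
    by_cases hanswer : answer.length = (A.circuit n).out.length
    · exact (SimState.computes_wires.listEq (.const _ hanswer) (fun x => x.1.toList_length)
        fun _ => hanswer).mono (by omega)
    · refine ((Computes.const _ (l := [false]) rfl).mono (by omega)).congr fun x _ => ?_
      rw [decide_eq_false]
      exact fun heq => hanswer (heq ▸ x.1.toList_length)
  proportion_le D out _ := by
    simp only [decide_eq_true_eq]
    exact toOuterMeasure_eq_attribute_le_chance φ _ out

/-- The number of gates that suffice to look up the first word of the output in the table and to
compare its content, moved, with the second word of the output. -/
def altersCost (n : ℕ) : ℕ :=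
  2 * (E.ctLen n * 2 + lookupCost w (E.ctLen n) n (3 * (A.view n).length + (A.circuit n).size)) +
    addCost n + n * 46 + 24

theorem decidesByOffset_alters :
    DecidesByOffset A E (A.alters E .observed (n := n))
      (fun _ δ out T => decide ((lookup (I.tag .data) (readWord (E.ctLen n) 0 out) T).map (· + δ) =
        some (readWord n (E.ctLen n) out)))
      (altersCost A E n) (1 / 2 ^ n) where
  mem_iff _ hr out := by
    rw [alters, Set.mem_ofPred_eq, contentOf_observed I hr, decide_eq_true_iff]
  computes _ δ t ht := by
    have hwires := SimState.computes_wires (w := w) (ℓ := E.ctLen n) (n := n)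
      (v := (A.circuit n).out.length) (t := t)
    have hfound := Computes.lookup (I.tag .data) (hwires.trans (.readWord _ (E.ctLen n) 0))
      SimState.computes_table fun x => x.2.toList_length
    have hmoved := hfound.value.add (Computes.const _ (length_wordBits δ))
    have hclaim := hwires.trans (.readWord _ n (E.ctLen n))
    have hrows : lookupCost w (E.ctLen n) n t ≤
        lookupCost w (E.ctLen n) n (3 * (A.view n).length + (A.circuit n).size) := by
      unfold lookupCost
      gcongr
    refine ((hfound.isSome.bool₂ (hmoved.wordEq hclaim) (· && ·)).mono ?_).congr fun x _ => ?_
    · unfold altersCost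
      omega
    · generalize lookup _ _ _ = content
      cases content <;> simp
  proportion_le _ out T := by
    simp only [decide_eq_true_eq]
    exact toOuterMeasure_map_add_eq_some_le _ _

variable {A E}

theorem exists_negligible_discovers_observed (hE : E.INDCPA) (hA : A.PolyTime) (t : ℕ → ℕ)
    (r : ∀ n, Fin (A.prog n).locs) (φ : ∀ n, BitVec n → List Bool) :
    ∃ ε : ℕ → ℝ, Negligible ε ∧
      ∀ n, prob (A.game E .observed n) (A.discovers E (t n) (r n) (φ n)) ≤ chance (φ n) + ε n :=
  exists_negligible_observed hE hA (fun n => chance_nonneg (φ n))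
    ((hA.2.mul (.const 44)).add (.const 4))
    fun n => decidesByOffset_discovers A E (t n) (r n) (φ n)

theorem exists_negligible_alters_observed (hE : E.INDCPA) (hA : A.PolyTime) :
    ∃ ε : ℕ → ℝ, Negligible ε ∧
      ∀ n, prob (A.game E .observed n) (A.alters E .observed) ≤ 1 / 2 ^ n + ε n := by
  have hrows : PolyBounded fun n => 3 * (A.view n).length + (A.circuit n).size :=
    ((PolyBounded.const 3).mul hA.1).add hA.2
  have hcost : PolyBounded fun n => altersCost A E n :=
    ((((PolyBounded.const 2).mul ((E.ctLen_poly.mul (.const 2)).add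
      (.lookupCost E.ctLen_poly hrows))).add .addCost).add (PolyBounded.id.mul (.const 46))).add
        (.const 24)
  exact exists_negligible_observed hE hA (fun n => by positivity) hcost
    fun n => decidesByOffset_alters A E

theorem alters_arbitrary_subset :
    A.alters E .arbitrary (n := n) ⊆ A.alters E .observed ∪ A.forges E n := by
  refine fun o halters => or_iff_not_imp_right.2 fun hgenuine => ?_
  have hcontent := contentOf_arbitrary_of_notMem_forgery I hgenuine .data
  rw [zero_mul] at hcontent
  exact hcontent.symm.trans halters

theorem exists_negligible_alters_arbitrary (hE : E.INDCPA) (hE' : E.INTCTXT) (hA : A.PolyTime) :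
    ∃ ε : ℕ → ℝ, Negligible ε ∧
      ∀ n, prob (A.game E .arbitrary n) (A.alters E .arbitrary) ≤ 1 / 2 ^ n + ε n := by
  obtain ⟨ε, hε, halters⟩ := exists_negligible_alters_observed hE hA
  obtain ⟨ν, hν, hforge⟩ := exists_negligible_arbitrary hE' hA
  refine ⟨ε + (ν + ν), hε.add (hν.add hν), fun n => ?_⟩
  obtain ⟨hforges, harbitrary⟩ := hforge n
  have hunion := (prob_mono (A.game E .observed n) alters_arbitrary_subset).trans
    (prob_union_le _ _ _)
  simp only [Pi.add_apply]
  linarith [halters n, harbitrary (A.alters E .arbitrary)]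

theorem exists_negligible_discovers_arbitrary (hE : E.INDCPA) (hE' : E.INTCTXT)
    (hA : A.PolyTime) (t : ℕ → ℕ) (r : ∀ n, Fin (A.prog n).locs) (φ : ∀ n, BitVec n → List Bool) :
    ∃ ε : ℕ → ℝ, Negligible ε ∧
      ∀ n, prob (A.game E .arbitrary n) (A.discovers E (t n) (r n) (φ n)) ≤
        chance (φ n) + ε n := by
  obtain ⟨ε, hε, hdiscovers⟩ := exists_negligible_discovers_observed hE hA t r φ
  obtain ⟨ν, hν, hforge⟩ := exists_negligible_arbitrary hE' hA
  refine ⟨ε + ν, hε.add hν, fun n => ((hforge n).2 _).trans ?_⟩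
  simp only [Pi.add_apply]
  linarith [hdiscovers n]

end Operator

theorem mainTheorem7 {w : ℕ} (E : Encryption w) (I : InstructionSet w) :
    (E.INDCPA → ResistsAttacks E I Interference.observed) ∧
      (E.INDCPA → E.INTCTXT → ResistsAttacks E I Interference.arbitrary) :=
  ⟨fun hE _ hA => ⟨Operator.exists_negligible_discovers_observed hE hA,
      Operator.exists_negligible_alters_observed hE hA⟩,
    fun hE hE' _ hA => ⟨Operator.exists_negligible_discovers_arbitrary hE hE' hA,
      Operator.exists_negligible_alters_arbitrary hE hE' hA⟩⟩
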